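/- Consider a Markov decision process with finitely many non-sink states $\mathcal S$, a sink state $e$, finitely many (at least one) actions $\mathcal A$, transition probabilities $\bar p(s,a,s')$, real rewards $\bar r(s,a,s')$ of arbitrary sign with $\bar p(e,a,e)=1$, $\bar r(e,a,e)=0$, and an initial distribution $\mu$ with $\mu_e=0$ and $\mu_s>0$ for all $s\in\mathcal S$. Assume that it is transient: for every stationary deterministic policy $\pi\in\Pi_{\mathrm{SD}}$ and all $s,s'\in\mathcal S$, $\sum_{t\ge 0}\mathbb P^{\pi,s}[\tilde s_t=s']<\infty$. Let $\Pi_{\mathrm{HR}}$ be the set of history-dependent randomized policies, and let $R_t=\sum_{k=0}^{t}\bar r(\tilde s_k,\tilde a_k,\tilde s_{k+1})$. Put \[ \mathrm{ERM}_\beta[X]=-\beta^{-1}\log\mathbb E[e^{-\beta X}]\ (\beta>0),\qquad \mathrm{ERM}_0[X]=\mathbb E[X],\qquad \mathrm{EVaR}_\alpha[X]=\sup_{\beta>0}\,-\beta^{-1}\log\bigl(\alpha^{-1}\mathbb E[e^{-\beta X}]\bigr), \] \[ g_t(\pi,\beta)=\mathrm{ERM}^{\pi,\mu}_\beta[R_t],\quad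 g_t^\star(\beta)=\sup_{\pi\in\Pi_{\mathrm{HR}}}g_t(\pi,\beta),\quad g_\infty(\pi,\beta)=\liminf_{t\to\infty}g_t(\pi,\beta),\quad g^\star_\infty(\beta)=\liminf_{t\to\infty}g^\star_t(\beta) \] (values in $[-\infty,\infty]$), and $h_t(\pi,\beta)=g_t(\pi,\beta)+\beta^{-1}\log\alpha$, $h_\infty(\pi,\beta)=g_\infty(\pi,\beta)+\beta^{-1}\log\alpha$. Let $\alpha\in(0,1)$, $\delta>0$ and $\beta_0>0$. The grid $\mathcal B(\beta_0,\delta)=\{\beta_0,\dots,\beta_K\}$ is given by \[ \beta_{k+1}=\min\Bigl\{\frac{\beta_k\log\alpha}{\beta_k\delta+\log\alpha},\ \frac{-\log\alpha}{\delta}\Bigr\}, \] where $K$ is the first index with $\beta_K\ge -\log(\alpha)/\delta$ (thus $\beta_K=-\log(\alpha)/\delta$ if $\beta_0\le-\log(\alpha)/\delta$, and the grid is $\{\beta_0\}$ otherwise). The simple EVaR algorithm, started with $\beta_0$, does the following. 1. While $g^\star_\infty(0)-g^\star_\infty(\beta_0)>\delta$, replace $\beta_0$ by $\beta_0/2$.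 2. Return some $\pi^\star\in\operatorname{argmax}_{\pi\in\Pi_{\mathrm{SD}}}\max_{\beta\in\mathcal B(\beta_0,\delta)}h_\infty(\pi,\beta)$, computed by solving, for each $\beta\in\mathcal B(\beta_0,\delta)$, the linear program \[ \min\Bigl\{\sum_{s\in\mathcal S}w_s \;\Big|\; w\in\mathbb R^{\mathcal S},\ w_s\ge (L^a w)_s\ \ \forall s\in\mathcal S,\ a\in\mathcal A\Bigr\},\qquad (L^aw)_s=\sum_{s'\in\mathcal S}\bar p(s,a,s')e^{-\beta \bar r(s,a,s')}w_{s'}-\bar p(s,a,e)e^{-\beta \bar r(s,a,e)}. \] That is: among the $\beta\in\mathcal B(\beta_0,\delta)$ whose program has an optimal solution $w^\beta$, take one with the largest value $-\beta^{-1}\log\bigl(\sum_s\mu_s(-w^\beta_s)\bigr)+\beta^{-1}\log\alpha$, and return a $\pi^\star$ with $(L^{\pi^\star(s)}w^\beta)_s=w^\beta_s$ for all $s\in\mathcal S$. Then: (a) The loop terminates after finitely many halvings, with a value $\beta_0>0$, and $\mathcal B(\beta_0,\delta)$ is finite. (b) The linear-programming step returns some policy, and every policy that it may return lies in $\operatorname{argmax}_{\pi\in\Pi_{\mathrm{SD}}}\max_{\beta\in\mathcal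 B(\beta_0,\delta)}h_\infty(\pi,\beta)$ for the final $\beta_0$. (c) For every $\pi\in\Pi_{\mathrm{HR}}$ the limits $\lim_{t\to\infty}\mathrm{EVaR}^{\pi,\mu}_\alpha[R_t]$ and $\lim_{t\to\infty}\sup_{\beta>0}h_t(\pi,\beta)$ exist in $[-\infty,\infty]$ and are equal, and every $\pi^\star$ in the argmax of step 2 (in particular every policy that the algorithm may return) is $\delta$-optimal: \[ \lim_{t\to\infty}\mathrm{EVaR}^{\pi^\star,\mu}_\alpha[R_t]\ \ge\ \sup_{\pi\in\Pi_{\mathrm{HR}}}\lim_{t\to\infty}\sup_{\beta>0}h_t(\pi,\beta)-\delta . \] -/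

import Mathlib

open Filter Topology

universe u

/-! ### Risk measures of random variables on a finite probability space -/

/-- Expectation of `X` on a finite sample space with probability weights `P`. -/
noncomputable def expect {Ω : Type u} [Fintype Ω] (P X : Ω → ℝ) : ℝ :=
  ∑ ω, P ω * X ω

/-- Entropic risk measure at risk level `β ≥ 0`; at `β = 0` it is the expectation. -/
noncomputable def erm {Ω : Type u} [Fintype Ω] (P : Ω → ℝ) (β : ℝ) (X : Ω → ℝ) : ℝ :=
  if β = 0 then expect P X
  else -β⁻¹ * Real.log (expect P fun ω => Real.exp (-β * X ω))

/-- Entropic value at risk at level `α ∈ (0, 1)`. -/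
noncomputable def evar {Ω : Type u} [Fintype Ω] (P : Ω → ℝ) (α : ℝ) (X : Ω → ℝ) : EReal :=
  ⨆ (β : ℝ) (_ : 0 < β),
    ((-β⁻¹ * Real.log (α⁻¹ * expect P fun ω => Real.exp (-β * X ω)) : ℝ) : EReal)

/-! ### Markov decision processes with a sink state -/

/-- A finite MDP with non-sink states `S` and actions `A`. The full state space is `Option S`,
and `none` is the sink state. -/
structure MDP (S A : Type u) [Fintype S] [Fintype A] where
  /-- transition probabilities `p s a s'` -/
  p : Option S → A → Option S → ℝ
  p_nonneg : ∀ s a s', 0 ≤ p s a s'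
  p_sum : ∀ s a, ∑ s', p s a s' = 1
  /-- rewards `r s a s'` -/
  r : Option S → A → Option S → ℝ
  /-- initial state distribution -/
  μ : Option S → ℝ
  μ_nonneg : ∀ s, 0 ≤ μ s
  μ_sum : ∑ s, μ s = 1
  p_sink : ∀ a, p none a none = 1
  r_sink : ∀ a, r none a none = 0
  μ_sink : μ none = 0

/-- Histories `(s₀, a₀, s₁, a₁, …, a_{k-1}, s_k)`, as nested tuples `((h, a_{k-1}, s_k))`. -/
def History (S A : Type u) : ℕ → Type u
  | 0 => Option S
  | k + 1 => History S A k × A × Option S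

namespace History

variable {S A : Type u}

instance instFintype [Fintype S] [Fintype A] : (k : ℕ) → Fintype (History S A k)
  | 0 => inferInstanceAs (Fintype (Option S))
  | k + 1 =>
    letI : Fintype (History S A k) := instFintype k
    inferInstanceAs (Fintype (History S A k × A × Option S))

/-- The current (last) state `s_k` of a history. -/
def last : (k : ℕ) → History S A k → Option S
  | 0, s => s
  | _ + 1, (_, _, s) => s

end History

/-- History-dependent randomized policies: a distribution over actions for every history. -/
structure Policy (S A : Type u) [Fintype A] where
  prob : (k : ℕ) → History S A k → A → ℝ
  prob_nonneg : ∀ k h a, 0 ≤ prob k h a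
  prob_sum : ∀ k h, ∑ a, prob k h a = 1

open Classical in
/-- The stationary deterministic policy given by a decision rule `d : S → A`, seen as a
history-dependent policy. (The action taken in the sink has no effect on any process.) -/
noncomputable def stationary {S A : Type u} [Fintype A] [Nonempty A] (d : S → A) :
    Policy S A where
  prob k h a := if a = (h.last k).elim (Classical.arbitrary A) d then 1 else 0
  prob_nonneg k h a := by split_ifs <;> norm_num
  prob_sum k h := by simp

namespace MDP

variable {S A : Type u} [Fintype S] [Fintype A] (M : MDP S A)

/-- Probability of a history when `s₀` has distribution `ν` and the actions follow `π`. -/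
noncomputable def histProb (ν : Option S → ℝ) (π : Policy S A) :
    (k : ℕ) → History S A k → ℝ
  | 0, s => ν s
  | k + 1, (h, a, s') => histProb ν π k h * π.prob k h a * M.p (h.last k) a s'

/-- The sum of the rewards collected along a history. -/
noncomputable def totalReward : (k : ℕ) → History S A k → ℝ
  | 0, _ => 0
  | k + 1, (h, a, s') => totalReward k h + M.r (h.last k) a s'

open Classical in
/-- The probability that the state at time `t` is `s'`, when started in `s` and following `π`. -/
noncomputable def stateProb (π : Policy S A) (s : S) (t : ℕ) (s' : S) : ℝ :=
  ∑ h : History S A t,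
    if h.last t = some s' then M.histProb (fun x => if x = some s then 1 else 0) π t h else 0

/-- Transience: under every stationary deterministic policy, the expected number of visits to
each non-sink state is finite, from each non-sink initial state. -/
def Transient [Nonempty A] : Prop :=
  ∀ (d : S → A) (s s' : S), Summable fun t => M.stateProb (stationary d) s t s'

/-- `g_t(π, β)`: the ERM of the sum of the rewards of the transitions `0, …, t`. -/
noncomputable def g (t : ℕ) (π : Policy S A) (β : ℝ) : ℝ :=
  erm (M.histProb M.μ π (t + 1)) β (M.totalReward (t + 1))

/-- `g_t^⋆(β)`. -/
noncomputable def gStar (t : ℕ) (β : ℝ) : EReal :=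
  ⨆ π : Policy S A, (M.g t π β : EReal)

/-- `g_∞(π, β)`. -/
noncomputable def gInf (π : Policy S A) (β : ℝ) : EReal :=
  liminf (fun t => (M.g t π β : EReal)) atTop

/-- `g_∞^⋆(β)`. -/
noncomputable def gInfStar (β : ℝ) : EReal :=
  liminf (fun t => M.gStar t β) atTop

/-- `h_t(π, β)`. -/
noncomputable def h (α : ℝ) (t : ℕ) (π : Policy S A) (β : ℝ) : ℝ :=
  M.g t π β + β⁻¹ * Real.log α

/-- `h_∞(π, β)`. -/
noncomputable def hInf (α : ℝ) (π : Policy S A) (β : ℝ) : EReal :=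
  M.gInf π β + ((β⁻¹ * Real.log α : ℝ) : EReal)

/-- The EVaR of the sum of the rewards of the transitions `0, …, t`. -/
noncomputable def evarReturn (α : ℝ) (t : ℕ) (π : Policy S A) : EReal :=
  evar (M.histProb M.μ π (t + 1)) α (M.totalReward (t + 1))

end MDP

/-! ### The grid of risk levels -/

/-- The grid points `β₀, β₁, …`: the recursion `b ↦ b log α / (b δ + log α)`, truncated at the
prescribed last point `- log α / δ`. -/
noncomputable def gridPoint (α δ β₀ : ℝ) : ℕ → ℝ
  | 0 => β₀
  | k + 1 =>
    min (gridPoint α δ β₀ k * Real.log α / (gridPoint α δ β₀ k * δ + Real.log α))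
      (-Real.log α / δ)

/-- The grid `{β₀, …, β_K}`, where `β_K` is the first grid point that reaches `- log α / δ`. -/
def grid (α δ β₀ : ℝ) : Set ℝ :=
  {b | ∃ K : ℕ, b = gridPoint α δ β₀ K ∧ ∀ k < K, gridPoint α δ β₀ k < -Real.log α / δ}

namespace MDP

variable {S A : Type u} [Fintype S] [Fintype A] (M : MDP S A)

/-! ### The linear program of an ERM problem -/

/-- `(L^a w)_s = (B^a w)_s - b^a_s`, the exponential Bellman operator of the action `a` at `s`. -/
noncomputable def bellman (β : ℝ) (w : S → ℝ) (s : S) (a : A) : ℝ :=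
  (∑ s' : S, M.p (some s) a (some s') * Real.exp (-β * M.r (some s) a (some s')) * w s')
    - M.p (some s) a none * Real.exp (-β * M.r (some s) a none)

/-- `w` is an optimal solution of the linear program
`min {∑ s, w s | w ≥ -b^a + B^a w for all actions a}`. -/
def IsLPSolution (β : ℝ) (w : S → ℝ) : Prop :=
  (∀ s a, M.bellman β w s a ≤ w s) ∧
    ∀ w' : S → ℝ, (∀ s a, M.bellman β w' s a ≤ w' s) → ∑ s, w s ≤ ∑ s, w' s

/-- The value `ERM_β^μ[v] + β⁻¹ log α` with `v_s = -β⁻¹ log (- w_s)`, computed from the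
exponential values `w`. -/
noncomputable def lpValue (α β : ℝ) (w : S → ℝ) : ℝ :=
  -β⁻¹ * Real.log (∑ s : S, M.μ (some s) * -w s) + β⁻¹ * Real.log α

/-! ### The simple EVaR algorithm -/

/-- The loop `while g_∞^⋆(0) - g_∞^⋆(β) > δ do β := β / 2`: `HalvingLoop M δ β β'` says that, if
started with `β`, it terminates with the value `β'`. -/
inductive HalvingLoop (δ : ℝ) : ℝ → ℝ → Prop
  | exit (β : ℝ) (h : ¬ M.gInfStar 0 - M.gInfStar β > (δ : EReal)) : HalvingLoop δ β β
  | step (β β' : ℝ) (h : M.gInfStar 0 - M.gInfStar β > (δ : EReal))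
      (hrest : HalvingLoop δ (β / 2) β') : HalvingLoop δ β β'

variable [Nonempty A]

/-- `d` lies in `argmax_{d} max_{b ∈ B} h_∞(d, b)`, where `d` ranges over the stationary
deterministic policies. -/
def IsArgmax (α : ℝ) (B : Set ℝ) (d : S → A) : Prop :=
  ∃ b ∈ B, ∀ d' : S → A, ∀ b' ∈ B,
    M.hInf α (stationary d') b' ≤ M.hInf α (stationary d) b

/-- `d` may be selected by solving the linear programs of all risk levels in `B`: some risk level
`b ∈ B` whose program has an optimal solution `w` has the best value among all such risk levels,
and the decision rule `d` satisfies `L^d w = w`. (A program without an optimal solution stands for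
the value `-∞`.) -/
def IsLPSelection (α : ℝ) (B : Set ℝ) (d : S → A) : Prop :=
  ∃ b ∈ B, ∃ w : S → ℝ, M.IsLPSolution b w ∧
    (∀ b' ∈ B, ∀ w' : S → ℝ, M.IsLPSolution b' w' → M.lpValue α b' w' ≤ M.lpValue α b w) ∧
    ∀ s, M.bellman b w s (d s) = w s

/-- Some run of the algorithm, started with `β₀`, terminates and returns `d`. -/
def EVaRAlgorithm (α δ β₀ : ℝ) (d : S → A) : Prop :=
  ∃ β, M.HalvingLoop δ β₀ β ∧ M.IsArgmax α (grid α δ β) d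

/-- Some run of the algorithm, with its last line carried out by linear programming, terminates
and returns `d`. -/
def EVaRAlgorithmLP (α δ β₀ : ℝ) (d : S → A) : Prop :=
  ∃ β, M.HalvingLoop δ β₀ β ∧ M.IsLPSelection α (grid α δ β) d

end MDP

/-! Split $E[e^{-\beta R_n}]$ into the mass absorbed in the sink by time $n$ and the mass still
alive. The sink pays nothing and is never left, so the absorbed mass is nondecreasing in $n$,
although rewards have arbitrary sign and the total mass need not be monotone. Transience gives a
step count $N$ after which every policy has absorbed a positive weighted mass from every state
(`Transient.exists_minIter_pos`). Alive mass at time $n$ therefore forces a proportional gain of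
absorbed mass by time $n+N$. If the absorbed mass stays bounded, the alive mass vanishes
(`Transient.tendsto_alive`) and total and absorbed mass have the same limit. Thus upper bounds on
absorbed mass control `gInf` from below, and lower bounds control every later `g` from above.

For fixed $\beta>0$, value iteration for the minimal absorbed mass, `minIter`, increases to a limit
$z$ or diverges somewhere. If $z$ is finite, it solves the exponential Bellman equation, a
stationary rule attains the minimum, and $-z$ is the unique solution of the linear program. If it
diverges, positivity of $\mu$ makes the optimal value $-\infty$, and the program is unbounded. So at
each $\beta$ stationary deterministic policies suffice and the programs compute their best value.

The loop stops because $g^\star_\infty(\beta)$ comes arbitrarily close to the risk-neutral optimum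
as $\beta\to0$: a slightly lowered risk-neutral value $x$ turns $1-\beta x$ into an exponential
supersolution (`Transient.exists_riskNeutral_value`). The limit of EVaR is $\sup_\beta h_\infty$:
compactness gives uniformity for bounded $\beta$, and a single bad absorbed history handles large
$\beta$ (`Transient.exists_forall_le_tilt`). Finally, ERM decreases in $\beta$, and
$\beta^{-1}\log\alpha$ rises by at most $\delta$ between neighbouring grid points. Levels above
$\beta_0$ therefore lose at most $\delta$ on the grid, and levels below lose at most $\delta$ by the
exit test of the loop. -/

namespace MDP

/-- The indicator function of the sink. -/
def sinkInd {S : Type u} : Option S → ℝ := fun s => s.elim 1 fun _ => 0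

@[simp] lemma sinkInd_none {S : Type u} : sinkInd (none : Option S) = 1 := rfl

@[simp] lemma sinkInd_some {S : Type u} (s : S) : sinkInd (some s) = 0 := rfl

lemma sinkInd_nonneg {S : Type u} (s : Option S) : 0 ≤ sinkInd s := by cases s <;> simp

lemma sinkInd_le_one {S : Type u} (s : Option S) : sinkInd s ≤ 1 := by cases s <;> simp

/-- The point mass at a non-sink state. -/
noncomputable def pointMass {S : Type u} (s : S) : Option S → ℝ :=
  open Classical in fun x => if x = some s then 1 else 0

lemma pointMass_nonneg {S : Type u} (s : S) (x : Option S) : 0 ≤ pointMass s x := by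
  unfold pointMass; split_ifs <;> norm_num

variable {S A : Type u} [Fintype S] [Fintype A] (M : MDP S A)

/-! ### Exponentially tilted expectations along histories -/

/-- The exponentially weighted one-step expectation of `f` after action `a` in state `s`. -/
noncomputable def step (β : ℝ) (f : Option S → ℝ) (s : Option S) (a : A) : ℝ :=
  ∑ s', M.p s a s' * Real.exp (-β * M.r s a s') * f s'

/-- The expectation of `exp (-β R_n) f(s_n)`, where `R_n` is the reward of the first `n`
transitions. -/
noncomputable def tilt (β : ℝ) (ν : Option S → ℝ) (π : Policy S A) (n : ℕ) (f : Option S → ℝ) :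
    ℝ :=
  ∑ h : History S A n, M.histProb ν π n h * Real.exp (-β * M.totalReward n h) * f (h.last n)

lemma p_none_some (a : A) (s : S) : M.p none a (some s) = 0 := by
  have h := M.p_sum none a
  rw [Fintype.sum_option, M.p_sink] at h
  have h0 : ∑ s : S, M.p none a (some s) = 0 := by linarith
  exact (Finset.sum_eq_zero_iff_of_nonneg fun s _ => M.p_nonneg _ _ _).1 h0 s (Finset.mem_univ _)

@[simp] lemma step_none (β : ℝ) (f : Option S → ℝ) (a : A) : M.step β f none a = f none := by
  simp [step, Fintype.sum_option, M.p_none_some, M.p_sink, M.r_sink]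

lemma step_mono {β : ℝ} {f f' : Option S → ℝ} (h : ∀ s, f s ≤ f' s) (s : Option S) (a : A) :
    M.step β f s a ≤ M.step β f' s a :=
  Finset.sum_le_sum fun s' _ => mul_le_mul_of_nonneg_left (h s')
    (mul_nonneg (M.p_nonneg _ _ _) (Real.exp_pos _).le)

lemma step_nonneg {β : ℝ} {f : Option S → ℝ} (h : ∀ s, 0 ≤ f s) (s : Option S) (a : A) :
    0 ≤ M.step β f s a :=
  Finset.sum_nonneg fun s' _ => mul_nonneg
    (mul_nonneg (M.p_nonneg _ _ _) (Real.exp_pos _).le) (h s')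

lemma histProb_nonneg {ν : Option S → ℝ} (hν : ∀ s, 0 ≤ ν s) (π : Policy S A) :
    ∀ (n : ℕ) (h : History S A n), 0 ≤ M.histProb ν π n h
  | 0, s => hν s
  | n + 1, (h, _, _) => mul_nonneg (mul_nonneg (histProb_nonneg hν π n h) (π.prob_nonneg _ _ _))
      (M.p_nonneg _ _ _)

@[simp] lemma tilt_zero (β : ℝ) (ν : Option S → ℝ) (π : Policy S A) (f : Option S → ℝ) :
    M.tilt β ν π 0 f = ∑ s, ν s * f s := by
  simp only [tilt, totalReward, mul_zero, Real.exp_zero, mul_one]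
  rfl

lemma sum_history_succ {n : ℕ} (F : History S A (n + 1) → ℝ) :
    ∑ h : History S A (n + 1), F h = ∑ h : History S A n, ∑ a : A, ∑ s : Option S, F (h, a, s) := by
  refine (Fintype.sum_prod_type (α₁ := History S A n) (α₂ := A × Option S) F).trans ?_
  exact Finset.sum_congr rfl fun h _ => Fintype.sum_prod_type _

lemma tilt_succ (β : ℝ) (ν : Option S → ℝ) (π : Policy S A) (n : ℕ) (f : Option S → ℝ) :
    M.tilt β ν π (n + 1) f = ∑ h : History S A n,
      M.histProb ν π n h * Real.exp (-β * M.totalReward n h) *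
        ∑ a, π.prob n h a * M.step β f (h.last n) a := by
  rw [tilt, sum_history_succ]
  refine Finset.sum_congr rfl fun h _ => ?_
  rw [Finset.mul_sum]
  refine Finset.sum_congr rfl fun a _ => ?_
  rw [step, Finset.mul_sum, Finset.mul_sum]
  refine Finset.sum_congr rfl fun s _ => ?_
  simp only [histProb, totalReward, History.last, mul_add, Real.exp_add]
  ring

variable {M}

lemma tilt_mono {β : ℝ} {ν : Option S → ℝ} (hν : ∀ s, 0 ≤ ν s) {π : Policy S A} {n : ℕ}
    {f f' : Option S → ℝ} (h : ∀ s, f s ≤ f' s) : M.tilt β ν π n f ≤ M.tilt β ν π n f' :=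
  Finset.sum_le_sum fun x _ => mul_le_mul_of_nonneg_left (h _)
    (mul_nonneg (M.histProb_nonneg hν π n x) (Real.exp_pos _).le)

lemma tilt_succ_le {β : ℝ} {ν : Option S → ℝ} (hν : ∀ s, 0 ≤ ν s) {π : Policy S A} {n : ℕ}
    {f f' : Option S → ℝ} (h : ∀ s a, M.step β f s a ≤ f' s) :
    M.tilt β ν π (n + 1) f ≤ M.tilt β ν π n f' := by
  rw [tilt_succ]
  refine Finset.sum_le_sum fun x _ => mul_le_mul_of_nonneg_left ?_
    (mul_nonneg (M.histProb_nonneg hν π n x) (Real.exp_pos _).le)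
  calc _ ≤ ∑ a, π.prob n x a * f' (x.last n) :=
        Finset.sum_le_sum fun a _ => mul_le_mul_of_nonneg_left (h _ _) (π.prob_nonneg _ _ _)
    _ = _ := by rw [← Finset.sum_mul, π.prob_sum, one_mul]

/-- A policy only averages over actions, so a one-step inequality that holds for every action
survives any history dependence and randomization. -/
lemma le_tilt_succ {β : ℝ} {ν : Option S → ℝ} (hν : ∀ s, 0 ≤ ν s) {π : Policy S A} {n : ℕ}
    {f f' : Option S → ℝ} (h : ∀ s a, f' s ≤ M.step β f s a) :
    M.tilt β ν π n f' ≤ M.tilt β ν π (n + 1) f := by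
  rw [tilt_succ]
  refine Finset.sum_le_sum fun x _ => mul_le_mul_of_nonneg_left ?_
    (mul_nonneg (M.histProb_nonneg hν π n x) (Real.exp_pos _).le)
  calc f' (x.last n) = ∑ a, π.prob n x a * f' (x.last n) := by
        rw [← Finset.sum_mul, π.prob_sum, one_mul]
    _ ≤ _ := Finset.sum_le_sum fun a _ => mul_le_mul_of_nonneg_left (h _ _) (π.prob_nonneg _ _ _)

lemma tilt_stationary_succ [Nonempty A] (β : ℝ) (ν : Option S → ℝ) (d : S → A) (n : ℕ)
    (f : Option S → ℝ) :
    M.tilt β ν (stationary d) (n + 1) f = M.tilt β ν (stationary d) n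
      fun s => M.step β f s (s.elim (Classical.arbitrary A) d) := by
  classical
  rw [tilt_succ, tilt]
  refine Finset.sum_congr rfl fun x _ => ?_
  simp [stationary]

lemma tilt_add (β : ℝ) (ν : Option S → ℝ) (π : Policy S A) (n : ℕ) (f f' : Option S → ℝ) :
    M.tilt β ν π n (fun s => f s + f' s) = M.tilt β ν π n f + M.tilt β ν π n f' := by
  simp only [tilt, mul_add, Finset.sum_add_distrib]

lemma tilt_const_mul (β : ℝ) (ν : Option S → ℝ) (π : Policy S A) (n : ℕ) (c : ℝ)
    (f : Option S → ℝ) :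
    M.tilt β ν π n (fun s => c * f s) = c * M.tilt β ν π n f := by
  simp only [tilt, Finset.mul_sum]
  exact Finset.sum_congr rfl fun _ _ => by ring

lemma tilt_nonneg {β : ℝ} {ν : Option S → ℝ} (hν : ∀ s, 0 ≤ ν s) {π : Policy S A} {n : ℕ}
    {f : Option S → ℝ} (h : ∀ s, 0 ≤ f s) : 0 ≤ M.tilt β ν π n f :=
  Finset.sum_nonneg fun x _ => mul_nonneg
    (mul_nonneg (M.histProb_nonneg hν π n x) (Real.exp_pos _).le) (h _)

/-- The total mass splits into the part absorbed in the sink and the remaining part. -/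
lemma tilt_one (β : ℝ) (ν : Option S → ℝ) (π : Policy S A) (n : ℕ) :
    M.tilt β ν π n (fun _ => 1)
      = M.tilt β ν π n sinkInd + M.tilt β ν π n (fun s => 1 - sinkInd s) := by
  rw [← tilt_add]
  simp

lemma tilt_zero_one {ν : Option S → ℝ} (π : Policy S A) (n : ℕ) :
    M.tilt 0 ν π n (fun _ => 1) = ∑ s, ν s := by
  induction n with
  | zero => simp
  | succ n ih =>
    rw [tilt_succ, ← ih, tilt]
    refine Finset.sum_congr rfl fun x _ => ?_
    simp [step, M.p_sum, π.prob_sum]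

lemma sinkInd_le_step (β : ℝ) (s : Option S) (a : A) : sinkInd s ≤ M.step β sinkInd s a := by
  cases s with
  | none => simp
  | some s => exact M.step_nonneg sinkInd_nonneg _ _

/-- The absorbed mass is nondecreasing in time. -/
lemma tilt_sinkInd_monotone {β : ℝ} {ν : Option S → ℝ} (hν : ∀ s, 0 ≤ ν s) (π : Policy S A) :
    Monotone fun n => M.tilt β ν π n sinkInd :=
  monotone_nat_of_le_succ fun _ => le_tilt_succ hν (sinkInd_le_step β)

/-- A supersolution for a stationary policy bounds its absorbed mass. -/
lemma tilt_stationary_sinkInd_le [Nonempty A] {β : ℝ} {ν : Option S → ℝ} (hν : ∀ s, 0 ≤ ν s)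
    {d : S → A} {z : Option S → ℝ} (hz : ∀ s, sinkInd s ≤ z s)
    (hd : ∀ s, M.step β z (some s) (d s) ≤ z (some s)) (n : ℕ) :
    M.tilt β ν (stationary d) n sinkInd ≤ ∑ s, ν s * z s := by
  refine (tilt_mono hν hz).trans ?_
  induction n with
  | zero => simp
  | succ n ih =>
    rw [tilt_stationary_succ]
    refine (tilt_mono hν fun s => ?_).trans ih
    cases s with
    | none => simp
    | some s => exact hd s

/-- A subsolution for a stationary policy is bounded by its tilted expectations. -/
lemma le_tilt_stationary [Nonempty A] {β : ℝ} {ν : Option S → ℝ} (hν : ∀ s, 0 ≤ ν s)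
    {d : S → A} {z : Option S → ℝ}
    (hd : ∀ s, z (some s) ≤ M.step β z (some s) (d s)) (n : ℕ) :
    ∑ s, ν s * z s ≤ M.tilt β ν (stationary d) n z := by
  induction n with
  | zero => simp
  | succ n ih =>
    rw [tilt_stationary_succ]
    refine ih.trans (tilt_mono hν fun s => ?_)
    cases s with
    | none => simp
    | some s => exact hd s

lemma sum_pointMass_mul (s : S) (z : Option S → ℝ) : ∑ x, pointMass s x * z x = z (some s) := by
  simp [pointMass]

/-! ### Transience in terms of tilted expectations -/

lemma stateProb_eq_tilt (π : Policy S A) (s : S) (t : ℕ) (s' : S) :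
    M.stateProb π s t s' = M.tilt 0 (pointMass s) π t (pointMass s') := by
  simp only [stateProb, tilt, pointMass, neg_zero, zero_mul, Real.exp_zero, mul_one, mul_ite,
    mul_zero]
  rfl

/-- Transience makes tilted expectations of functions vanishing at the sink tend to zero. -/
lemma Transient.tendsto_tilt [Nonempty A] (hM : M.Transient) (d : S → A) (s : S)
    {x : Option S → ℝ} (hx : x none = 0) :
    Tendsto (fun n => M.tilt 0 (pointMass s) (stationary d) n x) atTop (𝓝 0) := by
  have key : ∀ n, M.tilt 0 (pointMass s) (stationary d) n x
      = ∑ s' : S, x (some s') * M.stateProb (stationary d) s n s' := by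
    intro n
    have : x = fun y => ∑ s' : S, x (some s') * pointMass s' y := by
      funext y
      cases y with
      | none => simp [pointMass, hx]
      | some y =>
        rw [Finset.sum_eq_single y (fun s' _ h => by simp [pointMass, h.symm]) (by simp)]
        simp [pointMass]
    simp only [stateProb_eq_tilt, ← tilt_const_mul]
    conv_lhs => rw [this]
    simp only [tilt, Finset.mul_sum]
    rw [Finset.sum_comm]
  simp only [key]
  rw [show (0 : ℝ) = ∑ s' : S, x (some s') * 0 by simp]
  exact tendsto_finsetSum _ fun s' _ => (hM d s s').tendsto_atTop_zero.const_mul _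

end MDP

namespace MDP

/-- The extension of a function on the non-sink states by the value `c` at the sink. -/
def sinkExt {S : Type u} (c : ℝ) (v : S → ℝ) : Option S → ℝ := fun s => s.elim c v

@[simp] lemma sinkExt_none {S : Type u} (c : ℝ) (v : S → ℝ) : sinkExt c v none = c := rfl

@[simp] lemma sinkExt_some {S : Type u} (c : ℝ) (v : S → ℝ) (s : S) :
    sinkExt c v (some s) = v s := rfl

variable {S A : Type u} [Fintype S] [Fintype A] {M : MDP S A}

lemma step_zero_sinkExt (v : S → ℝ) (s : Option S) (a : A) :
    M.step 0 (sinkExt 0 v) s a = ∑ s' : S, M.p s a (some s') * v s' := by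
  simp [step, Fintype.sum_option]

/-! ### Risk-neutral optimal values -/

/-- Maximum principle: iterating $x\le Px$ gives $x\le P^nx$, and $P^nx\to0$ by transience. -/
lemma Transient.nonpos_of_le_step [Nonempty A] (hM : M.Transient) {d : S → A} {x : S → ℝ}
    (hx : ∀ s, x s ≤ M.step 0 (sinkExt 0 x) (some s) (d s)) (s : S) : x s ≤ 0 := by
  refine ge_of_tendsto' (hM.tendsto_tilt d s (x := sinkExt 0 x) rfl) fun n => ?_
  have h := le_tilt_stationary (M := M) (β := 0) (pointMass_nonneg s) (z := sinkExt 0 x) hx n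
  rwa [sum_pointMass_mul] at h

/-- The maximum principle, applied to $v$ and $-v$, makes $I-P$ injective, hence surjective in
finite dimension. -/
lemma Transient.exists_policy_value [Nonempty A] (hM : M.Transient) (d : S → A) (c : S → ℝ) :
    ∃ v : S → ℝ, ∀ s, v s = c s + M.step 0 (sinkExt 0 v) (some s) (d s) := by
  let L : (S → ℝ) →ₗ[ℝ] (S → ℝ) :=
    { toFun := fun v s => v s - ∑ s' : S, M.p (some s) (d s) (some s') * v s'
      map_add' := fun v w => by
        funext s
        simp only [Pi.add_apply, mul_add, Finset.sum_add_distrib]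
        ring
      map_smul' := fun k v => by
        funext s
        simp only [Pi.smul_apply, smul_eq_mul, RingHom.id_apply, mul_sub, Finset.mul_sum]
        congr 1
        exact Finset.sum_congr rfl fun _ _ => by ring }
  have hker : ∀ v, L v = 0 → ∀ s, v s ≤ 0 := fun v hv s => by
    refine hM.nonpos_of_le_step (d := d) (fun s => ?_) s
    have := congrFun hv s
    simp only [L, LinearMap.coe_mk, AddHom.coe_mk, Pi.zero_apply] at this
    rw [step_zero_sinkExt]
    linarith
  have hinj : Function.Injective L := by
    rw [injective_iff_map_eq_zero]
    intro v hv
    funext s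
    refine le_antisymm (hker v hv s) ?_
    have := hker (-v) (by rw [map_neg, hv, neg_zero]) s
    simpa using this
  obtain ⟨v, hv⟩ := LinearMap.injective_iff_surjective.1 hinj c
  refine ⟨v, fun s => ?_⟩
  have := congrFun hv s
  simp only [L, LinearMap.coe_mk, AddHom.coe_mk] at this
  rw [step_zero_sinkExt]
  linarith

/-- Policy improvement: some stationary deterministic policy has a value function that solves the
risk-neutral optimality equation. -/
lemma Transient.exists_optimal [Nonempty A] (hM : M.Transient) (c : S → A → ℝ) :
    ∃ (d : S → A) (v : S → ℝ),
      (∀ s, v s = c s (d s) + M.step 0 (sinkExt 0 v) (some s) (d s)) ∧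
      ∀ s a, c s a + M.step 0 (sinkExt 0 v) (some s) a ≤ v s := by
  classical
  choose v hv using fun d : S → A => hM.exists_policy_value d fun s => c s (d s)
  -- An improving action at $s$ would give a rule $d'$ whose value is nowhere smaller, by the
  -- maximum principle for `v d - v d'`, and larger at $s$. This contradicts maximality of the sum.
  obtain ⟨d, hd⟩ := Finite.exists_max fun d : S → A => ∑ s, v d s
  refine ⟨d, v d, hv d, fun s a => ?_⟩
  by_contra! hlt
  set d' := Function.update d s a with hd'
  have hstep : ∀ x, v d x ≤ c x (d' x) + M.step 0 (sinkExt 0 (v d)) (some x) (d' x) := by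
    intro x
    by_cases hx : x = s
    · subst hx
      simpa [hd'] using hlt.le
    · simpa [hd', hx] using (hv d x).le
  have hle : ∀ x, v d x ≤ v d' x := by
    intro x
    have := hM.nonpos_of_le_step (d := d') (x := fun y => v d y - v d' y) (fun y => ?_) x
    · linarith
    · have h1 := hstep y
      have h2 := hv d' y
      simp only [step_zero_sinkExt, mul_sub, Finset.sum_sub_distrib] at h1 h2 ⊢
      linarith
  have hs : v d s < v d' s := by
    rw [hv d' s]
    have h1 : M.step 0 (sinkExt 0 (v d)) (some s) a ≤ M.step 0 (sinkExt 0 (v d')) (some s) a :=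
      step_mono _ (fun x => by cases x <;> simp [hle]) _ _
    simp only [hd', Function.update_self] at h1 ⊢
    linarith
  exact (hd d').not_gt (Finset.sum_lt_sum (fun x _ => hle x) ⟨s, Finset.mem_univ _, hs⟩)

/-- A Lyapunov function: the maximal expected time to absorption. -/
lemma Transient.exists_potential [Nonempty A] (hM : M.Transient) :
    ∃ φ : S → ℝ, (∀ s, 1 ≤ φ s) ∧ ∀ s a, 1 + M.step 0 (sinkExt 0 φ) (some s) a ≤ φ s := by
  obtain ⟨d, φ, hd, hφ⟩ := hM.exists_optimal fun _ _ => 1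
  have h0 : ∀ s, 0 ≤ φ s := by
    intro s
    have := hM.nonpos_of_le_step (d := d) (x := fun y => -φ y) (fun y => ?_) s
    · linarith
    · have := hd y
      simp only [step_zero_sinkExt, mul_neg, Finset.sum_neg_distrib] at this ⊢
      linarith
  refine ⟨φ, fun s => ?_, hφ⟩
  rw [hd s]
  have := M.step_nonneg (β := 0) (f := sinkExt 0 φ) (fun x => by cases x <;> simp [h0]) (some s) (d s)
  linarith

/-! ### Uniform absorption -/

/-- The expected time to absorption contracts geometrically. -/
lemma Transient.exists_contraction [Nonempty A] (hM : M.Transient) :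
    ∃ (φ : S → ℝ) (θ : ℝ), 0 ≤ θ ∧ θ < 1 ∧ (∀ s, 1 ≤ φ s) ∧
      (∀ s a, 1 + M.step 0 (sinkExt 0 φ) (some s) a ≤ φ s) ∧
      ∀ s a, M.step 0 (sinkExt 0 φ) s a ≤ θ * sinkExt 0 φ s := by
  obtain ⟨φ, h1, hφ⟩ := hM.exists_potential
  obtain ⟨K, hK⟩ := (Set.finite_range φ).bddAbove
  have hK' : ∀ s, φ s ≤ max K 1 := fun s => (hK ⟨s, rfl⟩).trans (le_max_left _ _)
  have hpos : 0 < max K 1 := lt_max_of_lt_right one_pos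
  -- Since $\varphi\le\max(K,1)$, the unit decrease of $\varphi$ per step is at least the fraction
  -- $\max(K,1)^{-1}$ of $\varphi$.
  refine ⟨φ, 1 - (max K 1)⁻¹, ?_, by simp, h1, hφ, ?_⟩
  · exact sub_nonneg.2 (inv_le_one_of_one_le₀ (le_max_right _ _))
  · intro s a
    cases s with
    | none => simp
    | some s =>
      have h2 : (max K 1)⁻¹ * φ s ≤ 1 := by
        rw [inv_mul_le_iff₀ hpos, mul_one]
        exact hK' s
      have := hφ s a
      simp only [sinkExt_some]
      linarith

lemma exists_reward_bound (M : MDP S A) : ∃ ρ : ℝ, 0 ≤ ρ ∧ ∀ s a s', |M.r s a s'| ≤ ρ := by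
  obtain ⟨K, hK⟩ := (Set.finite_range fun x : Option S × A × Option S =>
    |M.r x.1 x.2.1 x.2.2|).bddAbove
  exact ⟨max K 0, le_max_right _ _, fun s a s' => (hK ⟨(s, a, s'), rfl⟩).trans (le_max_left _ _)⟩

/-- The minimal exponentially weighted probability of absorption within `n` steps. -/
noncomputable def minIter (M : MDP S A) (β : ℝ) : ℕ → Option S → ℝ
  | 0 => sinkInd
  | n + 1 => fun s => ⨅ a, M.step β (minIter M β n) s a

lemma minIter_succ_le (β : ℝ) (n : ℕ) (s : Option S) (a : A) :
    M.minIter β (n + 1) s ≤ M.step β (M.minIter β n) s a :=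
  ciInf_le (Set.finite_range _).bddBelow a

lemma le_minIter_succ [Nonempty A] {β : ℝ} {n : ℕ} {s : Option S} {x : ℝ}
    (h : ∀ a, x ≤ M.step β (M.minIter β n) s a) : x ≤ M.minIter β (n + 1) s :=
  le_ciInf h

lemma minIter_nonneg [Nonempty A] (β : ℝ) (n : ℕ) (s : Option S) : 0 ≤ M.minIter β n s := by
  induction n generalizing s with
  | zero => exact sinkInd_nonneg s
  | succ n ih => exact le_minIter_succ fun a => M.step_nonneg ih s a

@[simp] lemma minIter_none [Nonempty A] (β : ℝ) (n : ℕ) : M.minIter β n none = 1 := by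
  induction n with
  | zero => rfl
  | succ n ih => simp [minIter, ih]

lemma minIter_monotone [Nonempty A] (β : ℝ) (s : Option S) :
    Monotone fun n => M.minIter β n s := by
  refine monotone_nat_of_le_succ fun n => ?_
  induction n generalizing s with
  | zero => exact le_minIter_succ fun a => sinkInd_le_step β s a
  | succ n ih =>
    exact le_minIter_succ fun a => (minIter_succ_le β n s a).trans (M.step_mono ih s a)

/-- The absorbed mass of every policy is at least the minimal one. -/
lemma sum_minIter_le_tilt [Nonempty A] {β : ℝ} {ν : Option S → ℝ} (hν : ∀ s, 0 ≤ ν s)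
    (π : Policy S A) (n k : ℕ) :
    M.tilt β ν π n (M.minIter β k) ≤ M.tilt β ν π (n + k) sinkInd := by
  induction k generalizing n with
  | zero => exact le_rfl
  | succ k ih =>
    refine (le_tilt_succ hν (minIter_succ_le β k)).trans ?_
    rw [show n + (k + 1) = n + 1 + k by ring]
    exact ih (n + 1)

/-- From some number of steps on, absorption has positive weight, uniformly in the policy. -/
lemma Transient.exists_minIter_pos [Nonempty A] (hM : M.Transient) :
    ∃ N : ℕ, ∀ β : ℝ, ∃ c : ℝ, 0 < c ∧ ∀ s, c ≤ M.minIter β N s := by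
  obtain ⟨φ, θ, hθ0, hθ1, h1, -, hφ⟩ := hM.exists_contraction
  obtain ⟨ρ, hρ0, hρ⟩ := M.exists_reward_bound
  obtain ⟨K, hK⟩ := (Set.finite_range (sinkExt 0 φ)).bddAbove
  have hlim : Tendsto (fun n => θ ^ n * K) atTop (𝓝 0) := by
    simpa using (tendsto_pow_atTop_nhds_zero_of_lt_one hθ0 hθ1).mul_const K
  obtain ⟨N, hN⟩ := (hlim.eventually (ge_mem_nhds (show (0 : ℝ) < 1 / 2 by norm_num))).exists
  refine ⟨N, fun β => ⟨Real.exp (-(|β| * ρ)) ^ N * (1 / 2), by positivity, fun s => ?_⟩⟩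
  -- $1-\theta^n\varphi$ bounds the absorption probability from below, and each transition has
  -- weight at least $e^{-|\beta|\rho}$. The choice of $N$ depends only on the probabilities, so it
  -- serves all $\beta$.
  have key : ∀ n s, Real.exp (-(|β| * ρ)) ^ n * (1 - θ ^ n * sinkExt 0 φ s) ≤ M.minIter β n s := by
    intro n
    induction n with
    | zero =>
      intro s
      cases s with
      | none => simp [minIter]
      | some s => simp [minIter, h1]
    | succ n ih =>
      intro s
      refine le_minIter_succ fun a => ?_
      have hexp : ∀ s', Real.exp (-(|β| * ρ)) ≤ Real.exp (-β * M.r s a s') := fun s' => by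
        refine Real.exp_le_exp.2 ?_
        have : |β * M.r s a s'| ≤ |β| * ρ := by
          rw [abs_mul]; exact mul_le_mul_of_nonneg_left (hρ _ _ _) (abs_nonneg _)
        linarith [(abs_le.1 this).2]
      calc Real.exp (-(|β| * ρ)) ^ (n + 1) * (1 - θ ^ (n + 1) * sinkExt 0 φ s)
          = Real.exp (-(|β| * ρ)) ^ (n + 1) * (1 - θ ^ n * (θ * sinkExt 0 φ s)) := by ring
        _ ≤ Real.exp (-(|β| * ρ)) ^ (n + 1) * (1 - θ ^ n * M.step 0 (sinkExt 0 φ) s a) := by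
            gcongr
            exact hφ s a
        _ = ∑ s', M.p s a s' * Real.exp (-(|β| * ρ)) *
              (Real.exp (-(|β| * ρ)) ^ n * (1 - θ ^ n * sinkExt 0 φ s')) := by
            rw [show (1 : ℝ) = ∑ s', M.p s a s' from (M.p_sum s a).symm, step, Finset.mul_sum,
              ← Finset.sum_sub_distrib, Finset.mul_sum]
            refine Finset.sum_congr rfl fun s' _ => ?_
            rw [M.p_sum]
            simp only [neg_zero, zero_mul, Real.exp_zero]
            ring
        _ ≤ ∑ s', M.p s a s' * Real.exp (-(|β| * ρ)) * M.minIter β n s' :=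
            Finset.sum_le_sum fun s' _ => mul_le_mul_of_nonneg_left (ih s')
              (mul_nonneg (M.p_nonneg _ _ _) (Real.exp_pos _).le)
        _ ≤ M.step β (M.minIter β n) s a :=
            Finset.sum_le_sum fun s' _ => mul_le_mul_of_nonneg_right
              (mul_le_mul_of_nonneg_left (hexp s') (M.p_nonneg _ _ _)) (minIter_nonneg β n s')
  refine le_trans ?_ (key N s)
  have h2 : θ ^ N * sinkExt 0 φ s ≤ θ ^ N * K :=
    mul_le_mul_of_nonneg_left (hK ⟨s, rfl⟩) (pow_nonneg hθ0 _)
  have h3 : θ ^ N * K ≤ 1 / 2 := hN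
  gcongr
  linarith

/-- A policy whose absorbed mass stays bounded has vanishing remaining mass. -/
lemma Transient.tendsto_alive [Nonempty A] (hM : M.Transient) {β : ℝ} {ν : Option S → ℝ}
    (hν : ∀ s, 0 ≤ ν s) (π : Policy S A) {C : ℝ} (hC : ∀ n, M.tilt β ν π n sinkInd ≤ C) :
    Tendsto (fun n => M.tilt β ν π n fun s => 1 - sinkInd s) atTop (𝓝 0) := by
  obtain ⟨N, hN⟩ := hM.exists_minIter_pos
  obtain ⟨c, hc, hcN⟩ := hN β
  obtain ⟨L, hL⟩ : ∃ L, Tendsto (fun n => M.tilt β ν π n sinkInd) atTop (𝓝 L) :=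
    ⟨_, tendsto_atTop_ciSup (tilt_sinkInd_monotone hν π) ⟨C, by rintro _ ⟨n, rfl⟩; exact hC n⟩⟩
  have hdiff : Tendsto (fun n => c⁻¹ * (M.tilt β ν π (n + N) sinkInd - M.tilt β ν π n sinkInd))
      atTop (𝓝 0) := by
    simpa using (((tendsto_add_atTop_iff_nat N).2 hL).sub hL).const_mul c⁻¹
  refine squeeze_zero (fun n => tilt_nonneg hν fun s => sub_nonneg.2 (sinkInd_le_one s))
    (fun n => ?_) hdiff
  -- Of the mass alive at time $n$, at least the fraction $c$ is absorbed by time $n+N$, in addition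
  -- to what was absorbed already.
  rw [le_inv_mul_iff₀ hc, ← tilt_const_mul, le_sub_iff_add_le', ← tilt_add]
  refine le_trans (tilt_mono hν fun s => ?_) (sum_minIter_le_tilt hν π n N)
  cases s with
  | none => simp
  | some s => simpa using hcN (some s)

end MDP

namespace MDP

variable {S A : Type u} [Fintype S] [Fintype A] {M : MDP S A}

/-! ### Limits of entropic risk measures -/

lemma exists_histProb_pos (π : Policy S A) (n : ℕ) :
    ∃ h : History S A n, 0 < M.histProb M.μ π n h := by
  by_contra! hcon
  have h1 := M.tilt_zero_one (ν := M.μ) π n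
  have h2 : M.tilt 0 M.μ π n (fun _ => 1) ≤ 0 :=
    Finset.sum_nonpos fun h _ => by simpa using hcon h
  rw [M.μ_sum] at h1
  linarith

lemma tilt_one_pos (β : ℝ) (π : Policy S A) (n : ℕ) : 0 < M.tilt β M.μ π n fun _ => 1 := by
  obtain ⟨h, hh⟩ := M.exists_histProb_pos π n
  refine Finset.sum_pos' (fun x _ => ?_) ⟨h, Finset.mem_univ _, ?_⟩
  · have := M.histProb_nonneg M.μ_nonneg π n x
    positivity
  · positivity

lemma g_eq_log_tilt {β : ℝ} (hβ : β ≠ 0) (t : ℕ) (π : Policy S A) :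
    M.g t π β = -β⁻¹ * Real.log (M.tilt β M.μ π (t + 1) fun _ => 1) := by
  simp only [g, erm, if_neg hβ, expect, tilt, mul_one]

lemma tilt_sinkInd_le_tilt_one {β : ℝ} {ν : Option S → ℝ} (hν : ∀ s, 0 ≤ ν s) (π : Policy S A)
    (n : ℕ) : M.tilt β ν π n sinkInd ≤ M.tilt β ν π n fun _ => 1 :=
  tilt_mono hν sinkInd_le_one

/-- A lower bound for the absorbed mass gives an upper bound for the entropic risk measure. -/
lemma g_le_of_le_tilt {β x : ℝ} (hβ : 0 < β) (hx : 0 < x) {t n : ℕ} (hn : n ≤ t + 1)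
    {π : Policy S A} (h : x ≤ M.tilt β M.μ π n sinkInd) : M.g t π β ≤ -β⁻¹ * Real.log x := by
  rw [g_eq_log_tilt hβ.ne']
  have h1 : x ≤ M.tilt β M.μ π (t + 1) fun _ => 1 :=
    (h.trans (tilt_sinkInd_monotone M.μ_nonneg π hn)).trans
      (tilt_sinkInd_le_tilt_one M.μ_nonneg π _)
  have := mul_le_mul_of_nonneg_left (Real.log_le_log hx h1) (inv_pos.2 hβ).le
  linarith

lemma sum_minIter_le_tilt_sinkInd [Nonempty A] (β : ℝ) (π : Policy S A) (n : ℕ) :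
    ∑ s, M.μ s * M.minIter β n s ≤ M.tilt β M.μ π n sinkInd := by
  simpa using sum_minIter_le_tilt (M := M) (β := β) M.μ_nonneg π 0 n

/-- The minimal absorbed mass, with respect to the initial distribution, becomes positive. -/
lemma Transient.exists_sum_minIter_pos [Nonempty A] (hM : M.Transient) :
    ∃ N : ℕ, ∀ β : ℝ, 0 < ∑ s, M.μ s * M.minIter β N s := by
  obtain ⟨N, hN⟩ := hM.exists_minIter_pos
  refine ⟨N, fun β => ?_⟩
  obtain ⟨c, hc, h⟩ := hN β
  calc 0 < c := hc
    _ = ∑ s, M.μ s * c := by rw [← Finset.sum_mul, M.μ_sum, one_mul]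
    _ ≤ _ := Finset.sum_le_sum fun s _ => mul_le_mul_of_nonneg_left (h s) (M.μ_nonneg s)

/-- An upper bound for the absorbed mass gives a lower bound for the limiting risk measure. -/
lemma Transient.le_gInf_of_tilt_le [Nonempty A] (hM : M.Transient) {β C : ℝ} (hβ : 0 < β)
    {π : Policy S A} (hC : ∀ n, M.tilt β M.μ π n sinkInd ≤ C) :
    ((-β⁻¹ * Real.log C : ℝ) : EReal) ≤ M.gInf π β := by
  have hmono := tilt_sinkInd_monotone (M := M) (β := β) M.μ_nonneg π
  obtain ⟨L, hL⟩ : ∃ L, Tendsto (fun n => M.tilt β M.μ π n sinkInd) atTop (𝓝 L) :=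
    ⟨_, tendsto_atTop_ciSup hmono ⟨C, by rintro _ ⟨n, rfl⟩; exact hC n⟩⟩
  have hLC : L ≤ C := le_of_tendsto' hL hC
  obtain ⟨N, hN⟩ := hM.exists_sum_minIter_pos
  have hL0 : 0 < L := (hN β).trans_le ((sum_minIter_le_tilt_sinkInd β π N).trans
    (hmono.ge_of_tendsto hL N))
  have hE : Tendsto (fun n => M.tilt β M.μ π n fun _ => 1) atTop (𝓝 L) := by
    simp only [tilt_one]
    simpa using hL.add (hM.tendsto_alive M.μ_nonneg π hC)
  have hg : Tendsto (fun t => M.g t π β) atTop (𝓝 (-β⁻¹ * Real.log L)) := by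
    simp only [g_eq_log_tilt hβ.ne']
    exact (((tendsto_add_atTop_iff_nat 1).2 hE).log hL0.ne').const_mul _
  have hg' : M.gInf π β = ((-β⁻¹ * Real.log L : ℝ) : EReal) :=
    ((continuous_coe_real_ereal.tendsto _).comp hg).liminf_eq
  rw [hg', EReal.coe_le_coe_iff]
  have := mul_le_mul_of_nonneg_left (Real.log_le_log hL0 hLC) (inv_pos.2 hβ).le
  linarith

/-- A supersolution for a stationary policy bounds its limiting risk measure. -/
lemma Transient.le_gInf_stationary [Nonempty A] (hM : M.Transient) {β : ℝ} (hβ : 0 < β)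
    {d : S → A} {z : Option S → ℝ} (hz : ∀ s, sinkInd s ≤ z s)
    (hd : ∀ s, M.step β z (some s) (d s) ≤ z (some s)) :
    ((-β⁻¹ * Real.log (∑ s, M.μ s * z s) : ℝ) : EReal) ≤ M.gInf (stationary d) β :=
  hM.le_gInf_of_tilt_le hβ (tilt_stationary_sinkInd_le M.μ_nonneg hz hd)

lemma gInf_le_gInfStar (π : Policy S A) (β : ℝ) : M.gInf π β ≤ M.gInfStar β :=
  liminf_le_liminf (Eventually.of_forall fun t => le_iSup (fun π => (M.g t π β : EReal)) π)

/-! ### The limit of the minimal absorbed mass -/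

/-- `z` is the pointwise limit of the minimal absorbed masses. -/
def IsMinLimit (M : MDP S A) (β : ℝ) (z : Option S → ℝ) : Prop :=
  ∀ s, Tendsto (fun n => M.minIter β n s) atTop (𝓝 (z s))

/-- Monotone real sequences converge or diverge to infinity. Full support of $\mu$ carries
divergence at one state over to the average. -/
lemma exists_isMinLimit_or_tendsto [Nonempty A] (hμ : ∀ s : S, 0 < M.μ (some s)) (β : ℝ) :
    (∃ z, M.IsMinLimit β z) ∨
      ∃ s, Tendsto (fun n => M.minIter β n (some s)) atTop atTop ∧
        Tendsto (fun n => ∑ s, M.μ s * M.minIter β n s) atTop atTop := by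
  by_cases h : ∃ s : S, Tendsto (fun n => M.minIter β n (some s)) atTop atTop
  · obtain ⟨s, hs⟩ := h
    refine Or.inr ⟨s, hs, tendsto_atTop_mono (fun n => ?_) (hs.const_mul_atTop (hμ s))⟩
    exact Finset.single_le_sum (f := fun s => M.μ s * M.minIter β n s)
      (fun x _ => mul_nonneg (M.μ_nonneg x) (minIter_nonneg β n x)) (Finset.mem_univ _)
  · push Not at h
    left
    have : ∀ s : Option S, ∃ l, Tendsto (fun n => M.minIter β n s) atTop (𝓝 l) := by
      intro s
      cases s with
      | none => exact ⟨1, by simp⟩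
      | some s => exact (tendsto_atTop_of_monotone (minIter_monotone β (some s))).resolve_left (h s)
    choose z hz using this
    exact ⟨z, hz⟩

namespace IsMinLimit

variable {β : ℝ} {z : Option S → ℝ}

lemma none_eq [Nonempty A] (hz : M.IsMinLimit β z) : z none = 1 :=
  tendsto_nhds_unique (hz none) (by simp)

lemma minIter_le [Nonempty A] (hz : M.IsMinLimit β z) (n : ℕ) (s : Option S) : M.minIter β n s ≤ z s :=
  (minIter_monotone β s).ge_of_tendsto (hz s) n

lemma sinkInd_le [Nonempty A] (hz : M.IsMinLimit β z) (s : Option S) : sinkInd s ≤ z s := hz.minIter_le 0 s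

lemma tendsto_step (hz : M.IsMinLimit β z) (s : Option S) (a : A) :
    Tendsto (fun n => M.step β (M.minIter β n) s a) atTop (𝓝 (M.step β z s a)) :=
  tendsto_finsetSum _ fun s' _ => (hz s').const_mul _

lemma le_step (hz : M.IsMinLimit β z) (s : Option S) (a : A) : z s ≤ M.step β z s a :=
  le_of_tendsto_of_tendsto' ((tendsto_add_atTop_iff_nat 1).2 (hz s)) (hz.tendsto_step s a)
    fun n => minIter_succ_le β n s a

/-- With finitely many actions, if none attained equality in the limit, then for large $n$ none
would attain the infimum defining `minIter`. -/
lemma exists_step_eq [Nonempty A] (hz : M.IsMinLimit β z) (s : Option S) : ∃ a, M.step β z s a = z s := by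
  by_contra! hne
  have h1 : ∀ᶠ n in atTop, ∀ a, M.step β (M.minIter β n) s a ≠ M.minIter β (n + 1) s :=
    eventually_all.2 fun a =>
      (((hz.tendsto_step s a).sub ((tendsto_add_atTop_iff_nat 1).2 (hz s))).eventually_ne
        (sub_ne_zero.2 (hne a))).mono fun _ => sub_ne_zero.1
  obtain ⟨n, hn⟩ := h1.exists
  obtain ⟨a, ha⟩ := exists_eq_ciInf_of_finite (f := fun a => M.step β (M.minIter β n) s a)
  exact hn a ha

lemma exists_rule [Nonempty A] (hz : M.IsMinLimit β z) :
    ∃ d : S → A, ∀ s, M.step β z (some s) (d s) = z (some s) := by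
  choose d hd using fun s : S => hz.exists_step_eq (some s)
  exact ⟨d, hd⟩

lemma sum_pos [Nonempty A] (hz : M.IsMinLimit β z) (hM : M.Transient) : 0 < ∑ s, M.μ s * z s := by
  obtain ⟨N, hN⟩ := hM.exists_sum_minIter_pos
  exact (hN β).trans_le (Finset.sum_le_sum fun s _ =>
    mul_le_mul_of_nonneg_left (hz.minIter_le N s) (M.μ_nonneg s))

end IsMinLimit

/-- The bound does not depend on the policy. It holds only eventually because the logarithm needs a
positive minimal mass. -/
lemma Transient.gStar_le [Nonempty A] (hM : M.Transient) {β : ℝ} (hβ : 0 < β) :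
    ∀ᶠ t in atTop, M.gStar t β
      ≤ ((-β⁻¹ * Real.log (∑ s, M.μ s * M.minIter β (t + 1) s) : ℝ) : EReal) := by
  obtain ⟨N, hN⟩ := hM.exists_sum_minIter_pos
  filter_upwards [eventually_ge_atTop N] with t ht
  refine iSup_le fun π => EReal.coe_le_coe_iff.2 ?_
  refine g_le_of_le_tilt hβ ((hN β).trans_le ?_) le_rfl (sum_minIter_le_tilt_sinkInd β π _)
  exact Finset.sum_le_sum fun s _ =>
    mul_le_mul_of_nonneg_left (minIter_monotone β s (by omega)) (M.μ_nonneg s)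

lemma IsMinLimit.gInfStar_le [Nonempty A] {β : ℝ} {z : Option S → ℝ} (hz : M.IsMinLimit β z)
    (hM : M.Transient) (hβ : 0 < β) :
    M.gInfStar β ≤ ((-β⁻¹ * Real.log (∑ s, M.μ s * z s) : ℝ) : EReal) := by
  have h1 : Tendsto (fun t => ∑ s, M.μ s * M.minIter β (t + 1) s) atTop
      (𝓝 (∑ s, M.μ s * z s)) :=
    tendsto_finsetSum _ fun s _ => ((tendsto_add_atTop_iff_nat 1).2 (hz s)).const_mul _
  have h2 := (continuous_coe_real_ereal.tendsto _).comp
    ((h1.log (hz.sum_pos hM).ne').const_mul (-β⁻¹))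
  rw [← h2.liminf_eq]
  exact liminf_le_liminf (hM.gStar_le hβ)

lemma Transient.gInfStar_eq_bot [Nonempty A] (hM : M.Transient) {β : ℝ} (hβ : 0 < β)
    (h : Tendsto (fun n => ∑ s, M.μ s * M.minIter β n s) atTop atTop) : M.gInfStar β = ⊥ := by
  have h1 : Tendsto (fun t => -β⁻¹ * Real.log (∑ s, M.μ s * M.minIter β (t + 1) s)) atTop atBot :=
    (Real.tendsto_log_atTop.comp ((tendsto_add_atTop_iff_nat 1).2 h)).const_mul_atTop_of_neg
      (by simpa using hβ)
  have h2 := EReal.tendsto_coe_nhds_bot_iff.2 h1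
  rw [eq_bot_iff, ← h2.liminf_eq]
  exact liminf_le_liminf (hM.gStar_le hβ)

/-! ### The linear programs -/

/-- Dictionary for the sign convention of the program: with $z=-w$ and $z=1$ at the sink,
feasibility of $w$ reads $z\le$ `step` $z$ for all actions. -/
lemma step_sinkExt_neg (β : ℝ) (w : S → ℝ) (s : S) (a : A) :
    M.step β (sinkExt 1 fun s => -w s) (some s) a = -M.bellman β w s a := by
  simp [step, bellman, Fintype.sum_option, Finset.sum_neg_distrib]
  ring

lemma sum_μ_mul (f : Option S → ℝ) : ∑ s, M.μ s * f s = ∑ s : S, M.μ (some s) * f (some s) := by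
  simp [Fintype.sum_option, M.μ_sink]

/-- Iterate the subsolution $-w$ along a rule attaining $z$: it is at most absorbed mass plus a
constant times alive mass. The former stays below $z$, the latter vanishes. -/
lemma IsMinLimit.le_of_feasible [Nonempty A] {β : ℝ} {z : Option S → ℝ} (hz : M.IsMinLimit β z)
    (hM : M.Transient) {w : S → ℝ} (hw : ∀ s a, M.bellman β w s a ≤ w s) (s : S) :
    -z (some s) ≤ w s := by
  obtain ⟨d, hd⟩ := hz.exists_rule
  obtain ⟨K, hK⟩ := (Set.finite_range fun s => -w s).bddAbove
  have hA : ∀ n, M.tilt β (pointMass s) (stationary d) n sinkInd ≤ z (some s) := fun n => by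
    have := tilt_stationary_sinkInd_le (M := M) (pointMass_nonneg s) hz.sinkInd_le
      (fun s => (hd s).le) n
    rwa [sum_pointMass_mul] at this
  have hlim : Tendsto (fun n => z (some s) +
      K * M.tilt β (pointMass s) (stationary d) n fun s => 1 - sinkInd s) atTop
      (𝓝 (z (some s) + K * 0)) :=
    ((hM.tendsto_alive (pointMass_nonneg s) _ hA).const_mul K).const_add _
  have : -w s ≤ z (some s) + K * 0 := by
    refine ge_of_tendsto' hlim fun n => ?_
    have h1 := le_tilt_stationary (M := M) (β := β) (pointMass_nonneg s) (d := d)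
      (z := sinkExt 1 fun s => -w s)
      (fun s => by rw [step_sinkExt_neg, sinkExt_some]; exact neg_le_neg (hw _ _)) n
    rw [sum_pointMass_mul, sinkExt_some] at h1
    refine h1.trans ((tilt_mono (pointMass_nonneg s)
      (f' := fun x => sinkInd x + K * (1 - sinkInd x)) fun x => ?_).trans ?_)
    · cases x with
      | none => simp
      | some x => simpa using hK ⟨x, rfl⟩
    · rw [tilt_add, tilt_const_mul]
      exact add_le_add_left (hA n) _
  linarith

lemma IsMinLimit.isLPSolution [Nonempty A] {β : ℝ} {z : Option S → ℝ} (hz : M.IsMinLimit β z)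
    (hM : M.Transient) : M.IsLPSolution β fun s => -z (some s) := by
  refine ⟨fun s a => ?_, fun w hw => Finset.sum_le_sum fun s _ => hz.le_of_feasible hM hw s⟩
  have h1 := M.step_sinkExt_neg β (fun s => -z (some s)) s a
  have h2 : sinkExt 1 (fun s => - -z (some s)) = z := by
    funext x
    cases x <;> simp [hz.none_eq]
  rw [h2] at h1
  linarith [hz.le_step (some s) a]

/-- $-z$ is feasible and lies below every feasible point in each component, so equal objective
values force equality everywhere. -/
lemma IsMinLimit.eq_of_isLPSolution [Nonempty A] {β : ℝ} {z : Option S → ℝ}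
    (hz : M.IsMinLimit β z) (hM : M.Transient) {w : S → ℝ} (hw : M.IsLPSolution β w) :
    sinkExt 1 (fun s => -w s) = z := by
  have h1 := hw.2 _ (hz.isLPSolution hM).1
  have h2 := (Finset.sum_eq_sum_iff_of_le fun s _ => hz.le_of_feasible hM hw.1 s).1
    (h1.antisymm' (Finset.sum_le_sum fun s _ => hz.le_of_feasible hM hw.1 s))
  funext x
  cases x with
  | none => exact hz.none_eq.symm
  | some s => simp [← h2 s (Finset.mem_univ _)]

/-- The negated iterates are all feasible because `minIter` increases, and their objective is
unbounded below. -/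
lemma not_isLPSolution_of_tendsto [Nonempty A] {β : ℝ} {s : S}
    (h : Tendsto (fun n => M.minIter β n (some s)) atTop atTop) (w : S → ℝ) :
    ¬ M.IsLPSolution β w := by
  intro hw
  have h1 : ∀ n, M.minIter β n (some s) ≤ -∑ s, w s := by
    intro n
    have h2 := hw.2 (fun s => -M.minIter β n (some s)) fun s a => by
      have h1 := M.step_sinkExt_neg β (fun s => -M.minIter β n (some s)) s a
      have h2 : sinkExt 1 (fun s => - -M.minIter β n (some s)) = M.minIter β n := by
        funext x
        cases x <;> simp
      rw [h2] at h1
      linarith [minIter_succ_le (M := M) β n (some s) a,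
        minIter_monotone (M := M) β (some s) n.le_succ]
    rw [Finset.sum_neg_distrib] at h2
    have h3 := Finset.single_le_sum (f := fun s => M.minIter β n (some s))
      (fun x _ => minIter_nonneg β n (some x)) (Finset.mem_univ s)
    linarith
  obtain ⟨n, hn⟩ := (h.eventually_gt_atTop (-∑ s, w s)).exists
  exact (h1 n).not_gt hn

/-- A linear program with an optimal solution computes the minimal absorbed mass. -/
lemma IsLPSolution.isMinLimit [Nonempty A] {β : ℝ} {w : S → ℝ} (hw : M.IsLPSolution β w)
    (hμ : ∀ s : S, 0 < M.μ (some s)) (hM : M.Transient) :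
    M.IsMinLimit β (sinkExt 1 fun s => -w s) := by
  obtain ⟨z, hz⟩ | ⟨s, hs, -⟩ := exists_isMinLimit_or_tendsto hμ β
  · rwa [hz.eq_of_isLPSolution hM hw]
  · exact absurd hw (not_isLPSolution_of_tendsto hs w)

end MDP

namespace MDP

variable {S A : Type u} [Fintype S] [Fintype A] {M : MDP S A}

/-! ### Monotonicity of the entropic risk measure in the risk level -/

lemma expect_eq_tilt_one (β : ℝ) (π : Policy S A) (n : ℕ) :
    (expect (M.histProb M.μ π n) fun h => Real.exp (-β * M.totalReward n h))
      = M.tilt β M.μ π n fun _ => 1 := by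
  simp only [expect, tilt, mul_one]

lemma sum_histProb (π : Policy S A) (n : ℕ) : ∑ h, M.histProb M.μ π n h = 1 := by
  have := M.tilt_zero_one (ν := M.μ) π n
  simpa [tilt, M.μ_sum] using this

/-- For $\beta>0$ this is the power mean inequality with exponent $\beta'/\beta$. For $\beta=0$ the
exponential is bounded below by its tangent at the mean return. -/
lemma g_antitone {β β' : ℝ} (hβ : 0 ≤ β) (h : β ≤ β') (t : ℕ) (π : Policy S A) :
    M.g t π β' ≤ M.g t π β := by
  rcases h.eq_or_lt with rfl | hlt
  · exact le_rfl
  have hβ' : 0 < β' := hβ.trans_lt hlt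
  have hE' := tilt_one_pos (M := M) β' π (t + 1)
  rw [g_eq_log_tilt hβ'.ne', neg_mul, neg_le, le_inv_mul_iff₀ hβ']
  rcases hβ.eq_or_lt with rfl | hβ
  · rw [Real.le_log_iff_exp_le hE']
    set m := M.g t π 0 with hm
    have hm' : ∑ h, M.histProb M.μ π (t + 1) h * M.totalReward (t + 1) h = m := by
      simp [hm, g, erm, expect]
    calc Real.exp (β' * -m)
        = ∑ h, M.histProb M.μ π (t + 1) h *
            (Real.exp (β' * -m) * (1 - β' * (M.totalReward (t + 1) h - m))) := by
          have : ∀ h, M.histProb M.μ π (t + 1) h *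
              (Real.exp (β' * -m) * (1 - β' * (M.totalReward (t + 1) h - m)))
              = Real.exp (β' * -m) * (1 + β' * m) * M.histProb M.μ π (t + 1) h
                - Real.exp (β' * -m) * β' *
                  (M.histProb M.μ π (t + 1) h * M.totalReward (t + 1) h) := fun h => by ring
          simp only [this]
          rw [Finset.sum_sub_distrib, ← Finset.mul_sum, ← Finset.mul_sum, sum_histProb, hm']
          ring
      _ ≤ M.tilt β' M.μ π (t + 1) fun _ => 1 := by
          simp only [tilt, mul_one]
          refine Finset.sum_le_sum fun h _ => mul_le_mul_of_nonneg_left ?_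
            (M.histProb_nonneg M.μ_nonneg π _ h)
          have h1 := Real.add_one_le_exp (-β' * (M.totalReward (t + 1) h - m))
          calc _ ≤ Real.exp (β' * -m) * Real.exp (-β' * (M.totalReward (t + 1) h - m)) := by
                gcongr; linarith
            _ = _ := by rw [← Real.exp_add]; congr 1; ring
  · have hE := tilt_one_pos (M := M) β π (t + 1)
    rw [g_eq_log_tilt hβ.ne']
    have hp : 1 ≤ β' / β := (one_le_div hβ).2 hlt.le
    have key := Real.rpow_arith_mean_le_arith_mean_rpow Finset.univ
      (M.histProb M.μ π (t + 1)) (fun h => Real.exp (-β * M.totalReward (t + 1) h))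
      (fun h _ => M.histProb_nonneg M.μ_nonneg π _ h) (M.sum_histProb π _)
      (fun h _ => (Real.exp_pos _).le) hp
    have h1 : ∀ h, Real.exp (-β * M.totalReward (t + 1) h) ^ (β' / β)
        = Real.exp (-β' * M.totalReward (t + 1) h) := fun h => by
      rw [← Real.exp_mul]
      congr 1
      field_simp
    simp only [h1] at key
    have h2 := Real.log_le_log (by simpa [tilt] using Real.rpow_pos_of_pos hE (β' / β)) key
    rw [Real.log_rpow (by simpa [tilt] using hE)] at h2
    simp only [tilt, mul_one]
    calc _ = β' / β * Real.log (∑ h, M.histProb M.μ π (t + 1) h *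
            Real.exp (-β * M.totalReward (t + 1) h)) := by field_simp
      _ ≤ _ := h2

lemma gInfStar_antitone {β β' : ℝ} (hβ : 0 ≤ β) (h : β ≤ β') :
    M.gInfStar β' ≤ M.gInfStar β :=
  liminf_le_liminf (Eventually.of_forall fun t =>
    iSup_mono fun π => EReal.coe_le_coe_iff.2 (g_antitone hβ h t π))

/-! ### The risk-neutral problem and small risk levels -/

/-- The expected reward of action `a` in state `s`. -/
noncomputable def meanReward (M : MDP S A) (s : Option S) (a : A) : ℝ :=
  ∑ s', M.p s a s' * M.r s a s'

@[simp] lemma meanReward_none (a : A) : M.meanReward none a = 0 := by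
  simp [meanReward, Fintype.sum_option, M.p_none_some, M.r_sink]

/-- A supersolution of the risk-neutral optimality equation bounds expected returns. -/
lemma sum_totalReward_le {x : Option S → ℝ}
    (hx : ∀ s a, M.meanReward s a + M.step 0 x s a ≤ x s) (π : Policy S A) (n : ℕ) :
    ∑ h, M.histProb M.μ π n h * (M.totalReward n h + x (h.last n)) ≤ ∑ s, M.μ s * x s := by
  induction n with
  | zero =>
    simp only [totalReward, zero_add]
    exact le_rfl
  | succ n ih =>
    refine le_trans ?_ ih
    rw [sum_history_succ]
    refine Finset.sum_le_sum fun h _ => ?_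
    have h1 : ∀ a, ∑ s', M.histProb M.μ π (n + 1) (h, a, s') *
        (M.totalReward (n + 1) (h, a, s') + x (History.last (n + 1) (h, a, s')))
        = M.histProb M.μ π n h * (π.prob n h a * (M.totalReward n h
          + (M.meanReward (h.last n) a + M.step 0 x (h.last n) a))) := by
      intro a
      have h2 : M.totalReward n h = ∑ s', M.p (h.last n) a s' * M.totalReward n h := by
        rw [← Finset.sum_mul, M.p_sum, one_mul]
      rw [h2, meanReward, step, ← Finset.sum_add_distrib, ← Finset.sum_add_distrib, ← mul_assoc,
        Finset.mul_sum]
      refine Finset.sum_congr rfl fun s' _ => ?_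
      simp only [histProb, totalReward, History.last, neg_zero, zero_mul, Real.exp_zero]
      ring
    simp only [h1]
    rw [← Finset.mul_sum]
    refine mul_le_mul_of_nonneg_left ?_ (M.histProb_nonneg M.μ_nonneg π n h)
    calc _ ≤ ∑ a, π.prob n h a * (M.totalReward n h + x (h.last n)) :=
          Finset.sum_le_sum fun a _ => mul_le_mul_of_nonneg_left
            (by linarith [hx (h.last n) a]) (π.prob_nonneg _ _ _)
      _ = _ := by rw [← Finset.sum_mul, π.prob_sum, one_mul]

lemma tilt_zero_le_pow {x : Option S → ℝ} {θ : ℝ} (hθ : 0 ≤ θ)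
    (hx : ∀ s a, M.step 0 x s a ≤ θ * x s) (π : Policy S A) (n : ℕ) :
    M.tilt 0 M.μ π n x ≤ θ ^ n * ∑ s, M.μ s * x s := by
  induction n with
  | zero => simp
  | succ n ih =>
    refine (tilt_succ_le M.μ_nonneg hx).trans ?_
    rw [tilt_const_mul, pow_succ', mul_assoc]
    exact mul_le_mul_of_nonneg_left ih hθ

/-- The supersolution bounds the return plus a terminal term. That term is dominated by a multiple
of $\varphi$, whose expectation decays geometrically, uniformly in the policy. -/
lemma Transient.gInfStar_zero_le [Nonempty A] (hM : M.Transient) {v : S → ℝ}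
    (hv : ∀ s a, M.meanReward (some s) a + M.step 0 (sinkExt 0 v) (some s) a ≤ v s) :
    M.gInfStar 0 ≤ ((∑ s, M.μ s * sinkExt 0 v s : ℝ) : EReal) := by
  obtain ⟨φ, θ, hθ0, hθ1, h1, -, hφ⟩ := hM.exists_contraction
  obtain ⟨K, hK⟩ := (Set.finite_range fun s => |v s|).bddAbove
  have hg : ∀ t π, M.g t π 0 ≤ ∑ s, M.μ s * sinkExt 0 v s
      + |K| * (θ ^ (t + 1) * ∑ s, M.μ s * sinkExt 0 φ s) := by
    intro t π
    have h2 := sum_totalReward_le (M := M) (x := sinkExt 0 v)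
      (fun s a => by cases s <;> simp [hv]) π (t + 1)
    have h3 : -M.tilt 0 M.μ π (t + 1) (sinkExt 0 v)
        ≤ |K| * M.tilt 0 M.μ π (t + 1) (sinkExt 0 φ) := by
      rw [← neg_one_mul, ← tilt_const_mul, ← tilt_const_mul]
      refine tilt_mono M.μ_nonneg fun s => ?_
      cases s with
      | none => simp
      | some s =>
        have h4 : |v s| ≤ |K| := (hK ⟨s, rfl⟩).trans (le_abs_self K)
        simp only [sinkExt_some]
        nlinarith [neg_abs_le (v s), h1 s, abs_nonneg K]
    have h4 := mul_le_mul_of_nonneg_left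
      (tilt_zero_le_pow (M := M) hθ0 hφ π (t + 1)) (abs_nonneg K)
    have h5 : ∑ h, M.histProb M.μ π (t + 1) h *
        (M.totalReward (t + 1) h + sinkExt 0 v (h.last (t + 1)))
        = M.g t π 0 + M.tilt 0 M.μ π (t + 1) (sinkExt 0 v) := by
      simp [g, erm, expect, tilt, mul_add, Finset.sum_add_distrib]
    linarith
  have hlim : Tendsto (fun t : ℕ => ∑ s, M.μ s * sinkExt 0 v s
      + |K| * (θ ^ (t + 1) * ∑ s, M.μ s * sinkExt 0 φ s)) atTop
      (𝓝 (∑ s, M.μ s * sinkExt 0 v s + |K| * (0 * ∑ s, M.μ s * sinkExt 0 φ s))) :=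
    ((((tendsto_add_atTop_iff_nat 1).2
      (tendsto_pow_atTop_nhds_zero_of_lt_one hθ0 hθ1)).mul_const _).const_mul _).const_add _
  rw [zero_mul, mul_zero, add_zero] at hlim
  rw [← ((continuous_coe_real_ereal.tendsto _).comp hlim).liminf_eq]
  exact liminf_le_liminf (Eventually.of_forall fun t => iSup_le fun π =>
    EReal.coe_le_coe_iff.2 (hg t π))

/-- To first order in $\beta$ at $0$, the exponential supersolution inequality for $1-\beta x$ is
the risk-neutral subsolution inequality for $x$. Strictness there leaves room for the remainder. -/
lemma eventually_step_lt {x : S → ℝ} {s : S} {a : A}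
    (hx : x s < M.meanReward (some s) a + M.step 0 (sinkExt 0 x) (some s) a) :
    ∀ᶠ β in 𝓝[>] (0 : ℝ),
      M.step β (fun y => 1 - β * sinkExt 0 x y) (some s) a ≤ 1 - β * x s := by
  set F : ℝ → ℝ := fun β =>
    M.step β (fun y => 1 - β * sinkExt 0 x y) (some s) a - (1 - β * x s) with hF
  have hderiv : HasDerivAt F
      (∑ s', M.p (some s) a s' * (-M.r (some s) a s' - sinkExt 0 x s') + x s) 0 := by
    have h1 : ∀ s', HasDerivAt
        (fun β : ℝ => M.p (some s) a s' * Real.exp (-β * M.r (some s) a s')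
          * (1 - β * sinkExt 0 x s'))
        (M.p (some s) a s' * (-M.r (some s) a s' - sinkExt 0 x s')) 0 := by
      intro s'
      have h2 : HasDerivAt (fun β : ℝ => Real.exp (-β * M.r (some s) a s'))
          (-M.r (some s) a s') 0 := by
        simpa using (((hasDerivAt_id (0 : ℝ)).neg).mul_const (M.r (some s) a s')).exp
      have h3 : HasDerivAt (fun β : ℝ => 1 - β * sinkExt 0 x s') (-sinkExt 0 x s') 0 := by
        simpa using ((hasDerivAt_id (0 : ℝ)).mul_const (sinkExt 0 x s')).const_sub 1
      refine ((h2.const_mul (M.p (some s) a s')).mul h3).congr_deriv ?_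
      simp only [neg_zero, zero_mul, Real.exp_zero]
      ring
    have h4 : HasDerivAt (fun β : ℝ => 1 - β * x s) (-x s) 0 := by
      simpa using ((hasDerivAt_id (0 : ℝ)).mul_const (x s)).const_sub 1
    have h5 := (HasDerivAt.fun_sum (u := Finset.univ) fun s' _ => h1 s').sub h4
    rw [sub_neg_eq_add] at h5
    exact h5
  have hneg : ∑ s', M.p (some s) a s' * (-M.r (some s) a s' - sinkExt 0 x s') + x s < 0 := by
    have : ∑ s', M.p (some s) a s' * (-M.r (some s) a s' - sinkExt 0 x s')
        = -(M.meanReward (some s) a + M.step 0 (sinkExt 0 x) (some s) a) := by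
      simp only [meanReward, step, ← Finset.sum_add_distrib, ← Finset.sum_neg_distrib, neg_zero,
        zero_mul, Real.exp_zero]
      exact Finset.sum_congr rfl fun _ _ => by ring
    rw [this]
    linarith
  have h0 : F 0 = 0 := by simp [hF, step, M.p_sum, -Fintype.sum_option]
  have hslope := (hasDerivAt_iff_tendsto_slope.1 hderiv).eventually (gt_mem_nhds hneg)
  have hslope' := hslope.filter_mono (nhdsWithin_mono (0 : ℝ) fun y (hy : 0 < y) => hy.ne')
  filter_upwards [hslope', self_mem_nhdsWithin] with β hβ hpos
  rw [slope_def_field, h0, sub_zero, sub_zero] at hβ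
  have := (div_lt_iff₀ hpos).1 hβ
  simp only [hF, zero_mul] at this
  linarith

/-- The risk-neutral optimal value is approached by the entropic ones as the risk level tends to
zero. -/
lemma Transient.exists_riskNeutral_value [Nonempty A] (hM : M.Transient) :
    ∃ v : ℝ, M.gInfStar 0 ≤ (v : EReal) ∧
      ∀ ε > 0, ∀ᶠ β in 𝓝[>] (0 : ℝ), ((v - ε : ℝ) : EReal) ≤ M.gInfStar β := by
  obtain ⟨d, v, hd, hv⟩ := hM.exists_optimal fun s a => M.meanReward (some s) a
  refine ⟨_, hM.gInfStar_zero_le hv, fun ε hε => ?_⟩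
  obtain ⟨φ, h1, hφ⟩ := hM.exists_potential
  set m := ∑ s, M.μ s * sinkExt 0 φ s with hm
  have hm0 : 0 ≤ m := Finset.sum_nonneg fun s _ => mul_nonneg (M.μ_nonneg s) (by
    cases s with
    | none => simp
    | some s => exact zero_le_one.trans (h1 s))
  set η := ε / (m + 1) with hη
  have hη0 : 0 < η := by positivity
  have hηm : η * m ≤ ε := by
    rw [hη, div_mul_eq_mul_div, div_le_iff₀ (by positivity)]
    nlinarith
  -- Subtracting $\eta\varphi$ makes the optimality equation strict by at least $\eta$, at a cost of
  -- $\eta m\le\varepsilon$ in value.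
  set x : S → ℝ := fun s => v s - η * φ s with hx
  have hlt : ∀ s, x s < M.meanReward (some s) (d s)
      + M.step 0 (sinkExt 0 x) (some s) (d s) := by
    intro s
    have h2 := hd s
    have h3 := hφ s (d s)
    simp only [step_zero_sinkExt] at h2 h3 ⊢
    have h4 : ∑ s' : S, M.p (some s) (d s) (some s') * x s'
        = ∑ s' : S, M.p (some s) (d s) (some s') * v s'
          - η * ∑ s' : S, M.p (some s) (d s) (some s') * φ s' := by
      rw [Finset.mul_sum, ← Finset.sum_sub_distrib]
      exact Finset.sum_congr rfl fun _ _ => by simp only [hx]; ring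
    rw [h4]
    simp only [hx]
    nlinarith
  have hpos : ∀ y : ℝ, ∀ᶠ β in 𝓝[>] (0 : ℝ), 0 < 1 - β * y := fun y => by
    have : Tendsto (fun β : ℝ => 1 - β * y) (𝓝 0) (𝓝 (1 - 0 * y)) :=
      Continuous.tendsto (by fun_prop) 0
    exact (this.eventually (lt_mem_nhds (by simp))).filter_mono nhdsWithin_le_nhds
  filter_upwards [eventually_all.2 fun s => eventually_step_lt (hlt s),
    eventually_all.2 fun s => hpos (sinkExt 0 x s), hpos (∑ s, M.μ s * sinkExt 0 x s),
    self_mem_nhdsWithin] with β h2 h3 h4 (h5 : 0 < β)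
  refine le_trans ?_ ((hM.le_gInf_stationary h5 (d := d)
    (z := fun s => 1 - β * sinkExt 0 x s) (fun s => ?_) h2).trans (gInf_le_gInfStar _ _))
  · have h6 : ∑ s, M.μ s * (1 - β * sinkExt 0 x s) = 1 - β * ∑ s, M.μ s * sinkExt 0 x s := by
      rw [← M.μ_sum, Finset.mul_sum, ← Finset.sum_sub_distrib]
      refine Finset.sum_congr rfl fun _ _ => ?_
      rw [M.μ_sum]
      ring
    have h7 : ∑ s, M.μ s * sinkExt 0 x s = ∑ s, M.μ s * sinkExt 0 v s - η * m := by
      rw [hm, Finset.mul_sum, ← Finset.sum_sub_distrib]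
      refine Finset.sum_congr rfl fun s _ => ?_
      cases s with
      | none => simp
      | some s => simp only [sinkExt_some, hx]; ring
    rw [EReal.coe_le_coe_iff, h6]
    have h8 := Real.log_le_sub_one_of_pos h4
    have h9 : ∑ s, M.μ s * sinkExt 0 x s
        = -β⁻¹ * ((1 - β * ∑ s, M.μ s * sinkExt 0 x s) - 1) := by field_simp; ring
    have h10 := mul_le_mul_of_nonneg_left h8 (inv_pos.2 h5).le
    linarith
  · cases s with
    | none => simp
    | some s => exact (h3 (some s)).le

end MDP

namespace MDP

variable {S A : Type u} [Fintype S] [Fintype A] {M : MDP S A}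

/-! ### The limit of the entropic value at risk -/

lemma evarReturn_eq {α : ℝ} (hα : 0 < α) (t : ℕ) (π : Policy S A) :
    M.evarReturn α t π = ⨆ (β : ℝ) (_ : 0 < β), (M.h α t π β : EReal) := by
  refine iSup_congr fun β => iSup_congr fun hβ => ?_
  rw [h, g_eq_log_tilt hβ.ne', expect_eq_tilt_one,
    Real.log_mul (inv_pos.2 hα).ne' (tilt_one_pos β π _).ne', Real.log_inv]
  congr 1
  ring

lemma continuous_tilt (ν : Option S → ℝ) (π : Policy S A) (n : ℕ) (f : Option S → ℝ) :
    Continuous fun β => M.tilt β ν π n f := by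
  unfold tilt
  fun_prop

lemma hInf_le_liminf (α β : ℝ) (π : Policy S A) :
    M.hInf α π β ≤ liminf (fun t => (M.h α t π β : EReal)) atTop := by
  have h1 : M.hInf α π β = liminf (fun t => (M.g t π β : EReal)) atTop +
      liminf (fun _ : ℕ => ((β⁻¹ * Real.log α : ℝ) : EReal)) atTop := by
    rw [liminf_const]; rfl
  rw [h1]
  refine (EReal.le_liminf_add).trans (le_of_eq ?_)
  congr 1

lemma h_le_of_le_tilt {α β c : ℝ} (hα : 0 < α) (hβ : 0 < β) {t n : ℕ} (hn : n ≤ t + 1)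
    {π : Policy S A} (hc : α * Real.exp (-β * c) ≤ M.tilt β M.μ π n sinkInd) :
    M.h α t π β ≤ c := by
  have h1 := g_le_of_le_tilt hβ (by positivity) hn hc
  rw [Real.log_mul hα.ne' (Real.exp_pos _).ne', Real.log_exp] at h1
  have h2 : -β⁻¹ * (Real.log α + -β * c) = c - β⁻¹ * Real.log α := by field_simp; ring
  rw [h]
  linarith

variable [Nonempty A]

/-- If the absorbed mass never exceeded $\alpha e^{-\beta c}$, it would be bounded, the alive mass
would vanish, and $h_\infty\ge c$ would follow. -/
lemma Transient.exists_lt_tilt (hM : M.Transient) {α β c : ℝ} (hα : 0 < α) (hβ : 0 < β)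
    {π : Policy S A} (h : M.hInf α π β < c) :
    ∃ n, α * Real.exp (-β * c) < M.tilt β M.μ π n sinkInd := by
  by_contra! hcon
  have h1 := hM.le_gInf_of_tilt_le hβ hcon
  rw [Real.log_mul hα.ne' (Real.exp_pos _).ne', Real.log_exp] at h1
  have h2 : -β⁻¹ * (Real.log α + -β * c) = c - β⁻¹ * Real.log α := by field_simp; ring
  rw [h2] at h1
  have h3 := add_le_add_left h1 ((β⁻¹ * Real.log α : ℝ) : EReal)
  rw [← EReal.coe_add, sub_add_cancel] at h3
  exact h.not_ge h3

lemma Transient.tendsto_tilt_sinkInd_zero (hM : M.Transient) (π : Policy S A) :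
    Tendsto (fun n => M.tilt 0 M.μ π n sinkInd) atTop (𝓝 1) := by
  have h1 : ∀ n, M.tilt 0 M.μ π n sinkInd = 1 - M.tilt 0 M.μ π n fun s => 1 - sinkInd s := by
    intro n
    have h2 := tilt_one (M := M) 0 M.μ π n
    rw [tilt_zero_one, M.μ_sum] at h2
    linarith
  have h3 := hM.tendsto_alive M.μ_nonneg π (β := 0) (C := 1) fun n => by
    have h2 := tilt_sinkInd_le_tilt_one (M := M) (β := 0) M.μ_nonneg π n
    rwa [tilt_zero_one, M.μ_sum] at h2
  simp only [h1]
  simpa using h3.const_sub 1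

/-- A strict upper bound for all limiting risk measures is eventually a uniform upper bound. -/
lemma Transient.exists_forall_le_tilt (hM : M.Transient) {α c : ℝ} (hα0 : 0 < α) (hα1 : α < 1)
    {π : Policy S A} (hc : (⨆ (β : ℝ) (_ : 0 < β), M.hInf α π β) < c) :
    ∃ n, ∀ β > 0, α * Real.exp (-β * c) ≤ M.tilt β M.μ π n sinkInd := by
  have hlt : ∀ {β : ℝ} {y : EReal}, 0 < β → (⨆ (β : ℝ) (_ : 0 < β), M.hInf α π β) < y →
      M.hInf α π β < y := fun {β y} hβ hy =>
    (le_iSup₂ (f := fun (β : ℝ) (_ : 0 < β) => M.hInf α π β) β hβ).trans_lt hy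
  have hmono := fun β => tilt_sinkInd_monotone (M := M) (β := β) M.μ_nonneg π
  obtain ⟨c₁, hc₁, hc₁'⟩ := EReal.lt_iff_exists_real_btwn.1 hc
  obtain ⟨c₂, hc₂, hc₂'⟩ := EReal.lt_iff_exists_real_btwn.1 hc₁'
  rw [EReal.coe_lt_coe_iff] at hc₂ hc₂'
  have hlog := Real.log_neg hα0 hα1
  -- an absorbed history with a small return controls the large risk levels
  obtain ⟨n₁, x, hx, hxp, hxr⟩ : ∃ (n : ℕ) (x : History S A n), x.last n = none ∧
      0 < M.histProb M.μ π n x ∧ M.totalReward n x ≤ c₂ := by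
    -- At this level $\alpha e^{-\beta c_1}=e^{-\beta c_2}$. If all absorbed returns exceeded $c_2$,
    -- the absorbed mass could not exceed this value.
    have hβ : 0 < -Real.log α / (c₂ - c₁) := div_pos (by linarith) (by linarith)
    set β := -Real.log α / (c₂ - c₁) with hβdef
    obtain ⟨n, hn⟩ := hM.exists_lt_tilt hα0 hβ (hlt hβ hc₁)
    by_contra! hcon
    refine hn.not_ge ?_
    have h1 : α * Real.exp (-β * c₁) = Real.exp (-β * c₂) := by
      have h2 : α = Real.exp (-β * (c₂ - c₁)) := by
        rw [hβdef, neg_mul, div_mul_cancel₀ _ (by linarith), neg_neg, Real.exp_log hα0]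
      conv_lhs => rw [h2]
      rw [← Real.exp_add]
      congr 1
      ring
    rw [h1]
    calc M.tilt β M.μ π n sinkInd
        ≤ ∑ x, M.histProb M.μ π n x * Real.exp (-β * c₂) := by
          refine Finset.sum_le_sum fun x _ => ?_
          have h0 := M.histProb_nonneg M.μ_nonneg π n x
          rcases hlast : x.last n with _ | s
          · rw [sinkInd_none, mul_one]
            rcases h0.eq_or_lt with h0' | h0'
            · simp [← h0']
            · have := hcon n x hlast h0'
              exact mul_le_mul_of_nonneg_left (Real.exp_le_exp.2 (by nlinarith)) h0
          · rw [sinkInd_some, mul_zero]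
            positivity
      _ = Real.exp (-β * c₂) := by rw [← Finset.sum_mul, sum_histProb, one_mul]
  set p := M.histProb M.μ π n₁ x with hp
  -- From here on $e^{\beta(c-c_2)}\ge\beta(c-c_2)\ge\alpha/p$, so the one history of probability
  -- $p$ already contributes $\alpha e^{-\beta c}$.
  set β₂ := α / p / (c - c₂) with hβ₂
  have hlarge : ∀ β, β₂ ≤ β → α * Real.exp (-β * c) ≤ M.tilt β M.μ π n₁ sinkInd := by
    intro β hβ
    have hβ₂0 : 0 < β₂ := div_pos (by positivity) (by linarith)
    have h1 : α / p ≤ Real.exp (β * (c - c₂)) := by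
      have h2 := (div_le_iff₀ (by linarith)).1 hβ
      linarith [Real.add_one_le_exp (β * (c - c₂))]
    rw [div_le_iff₀ hxp] at h1
    calc α * Real.exp (-β * c) ≤ Real.exp (β * (c - c₂)) * p * Real.exp (-β * c) := by gcongr
      _ = p * Real.exp (-β * c₂) := by
          rw [mul_right_comm, ← Real.exp_add, mul_comm]
          congr 2
          ring
      _ ≤ p * Real.exp (-β * M.totalReward n₁ x) :=
          mul_le_mul_of_nonneg_left (Real.exp_le_exp.2 (by nlinarith)) hxp.le
      _ = M.histProb M.μ π n₁ x * Real.exp (-β * M.totalReward n₁ x)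
            * sinkInd (x.last n₁) := by rw [hx, sinkInd_none, mul_one]
      _ ≤ M.tilt β M.μ π n₁ sinkInd :=
          Finset.single_le_sum (f := fun x => M.histProb M.μ π n₁ x *
            Real.exp (-β * M.totalReward n₁ x) * sinkInd (x.last n₁))
            (fun x _ => mul_nonneg (mul_nonneg (M.histProb_nonneg M.μ_nonneg π n₁ x)
              (Real.exp_pos _).le) (sinkInd_nonneg _)) (Finset.mem_univ _)
  -- A Dini argument: these open sets increase with $n$ and cover the compact interval. The endpoint
  -- $\beta=0$ is covered because the absorption probability tends to $1>\alpha$.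
  obtain ⟨n₂, hn₂⟩ : ∃ n, Set.Icc 0 β₂ ⊆
      {β | α * Real.exp (-β * c) < M.tilt β M.μ π n sinkInd} := by
    refine isCompact_Icc.elim_directed_cover _
      (fun n => isOpen_lt (by fun_prop) (continuous_tilt _ _ _ _)) ?_ ?_
    · intro β hβ
      rw [Set.mem_iUnion]
      rcases hβ.1.eq_or_lt with h0 | h0
      · subst h0
        obtain ⟨n, hn⟩ := ((hM.tendsto_tilt_sinkInd_zero π).eventually (lt_mem_nhds hα1)).exists
        exact ⟨n, by simpa using hn⟩
      · exact hM.exists_lt_tilt hα0 h0 (hlt h0 hc)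
    · exact (directed_of_isDirected_le fun m n hmn β hβ => hβ.trans_le (hmono β hmn))
  refine ⟨max n₁ n₂, fun β hβ => ?_⟩
  rcases le_total β β₂ with h | h
  · exact (hn₂ ⟨hβ.le, h⟩).le.trans (hmono β (le_max_right _ _))
  · exact (hlarge β h).trans (hmono β (le_max_left _ _))

/-- The lower bound holds level by level. The upper bound needs one time that works for all levels
at once. -/
lemma Transient.tendsto_iSup_h (hM : M.Transient) {α : ℝ} (hα0 : 0 < α) (hα1 : α < 1)
    (π : Policy S A) :
    Tendsto (fun t => ⨆ (β : ℝ) (_ : 0 < β), (M.h α t π β : EReal)) atTop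
      (𝓝 (⨆ (β : ℝ) (_ : 0 < β), M.hInf α π β)) := by
  refine tendsto_of_le_liminf_of_limsup_le ?_ ?_
  · refine iSup₂_le fun β hβ => (hInf_le_liminf α β π).trans ?_
    exact liminf_le_liminf (Eventually.of_forall fun t =>
      le_iSup₂ (f := fun (β : ℝ) (_ : 0 < β) => (M.h α t π β : EReal)) β hβ)
  · by_contra! hcon
    obtain ⟨c, hc, hc'⟩ := EReal.lt_iff_exists_real_btwn.1 hcon
    obtain ⟨n, hn⟩ := hM.exists_forall_le_tilt hα0 hα1 hc
    refine hc'.not_ge (limsup_le_of_le (h := ?_))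
    filter_upwards [eventually_ge_atTop n] with t ht
    exact iSup₂_le fun β hβ => EReal.coe_le_coe_iff.2
      (h_le_of_le_tilt hα0 hβ (by omega) (hn β hβ))

end MDP

/-! ### The grid of risk levels -/

lemma gridPoint_mem_Ici {α δ β₀ : ℝ} (hα : Real.log α < 0) (hδ : 0 < δ) (hβ₀ : 0 < β₀) {K : ℕ}
    (hK : ∀ k < K, gridPoint α δ β₀ k < -Real.log α / δ) : β₀ ≤ gridPoint α δ β₀ K := by
  induction K with
  | zero => exact le_rfl
  | succ k ih =>
    have h1 := ih fun j hj => hK j (by omega)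
    have h2 := hK k (by omega)
    rw [lt_div_iff₀ hδ] at h2
    refine h1.trans (le_min ?_ (hK k (by omega)).le)
    rw [le_div_iff_of_neg (by linarith)]
    nlinarith [mul_pos (hβ₀.trans_le h1) (hβ₀.trans_le h1)]

/-- In the coordinate $b^{-1}\log\alpha$ the recursion is translation by $\delta$. -/
lemma gridPoint_inv {α δ b : ℝ} (hα : Real.log α < 0) (hδ : 0 < δ) (hb : 0 < b)
    (hlt : b < -Real.log α / δ) :
    0 < b * Real.log α / (b * δ + Real.log α) ∧
      (b * Real.log α / (b * δ + Real.log α))⁻¹ * Real.log α = b⁻¹ * Real.log α + δ := by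
  rw [lt_div_iff₀ hδ] at hlt
  have h1 : b * δ + Real.log α < 0 := by linarith
  have h2 := hα.ne
  have h3 := h1.ne
  refine ⟨div_pos_of_neg_of_neg (mul_neg_of_pos_of_neg hb hα) h1, ?_⟩
  field_simp
  ring

/-- Otherwise the truncation never acts, and the coordinate $b^{-1}\log\alpha$, always negative,
would grow by $\delta$ forever. -/
lemma exists_gridPoint_ge {α δ β₀ : ℝ} (hα : Real.log α < 0) (hδ : 0 < δ) (hβ₀ : 0 < β₀) :
    ∃ K, -Real.log α / δ ≤ gridPoint α δ β₀ K := by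
  by_contra! hcon
  have key : ∀ k : ℕ, (gridPoint α δ β₀ k)⁻¹ * Real.log α = β₀⁻¹ * Real.log α + k * δ := by
    intro k
    induction k with
    | zero => simp [gridPoint]
    | succ k ih =>
      have h1 : gridPoint α δ β₀ (k + 1)
          = gridPoint α δ β₀ k * Real.log α / (gridPoint α δ β₀ k * δ + Real.log α) :=
        min_eq_left ((min_lt_iff.1 (hcon (k + 1))).resolve_right (lt_irrefl _)).le
      rw [h1, (gridPoint_inv hα hδ
        (hβ₀.trans_le (gridPoint_mem_Ici hα hδ hβ₀ fun j _ => hcon j)) (hcon k)).2, ih]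
      push_cast
      ring
  obtain ⟨k, hk⟩ := exists_nat_ge (-(β₀⁻¹ * Real.log α) / δ)
  rw [div_le_iff₀ hδ] at hk
  have h1 := key k
  have h2 : (gridPoint α δ β₀ k)⁻¹ * Real.log α < 0 := mul_neg_of_pos_of_neg
    (inv_pos.2 (hβ₀.trans_le (gridPoint_mem_Ici hα hδ hβ₀ fun j _ => hcon j))) hα
  linarith

lemma grid_finite {α δ β₀ : ℝ} (hα : Real.log α < 0) (hδ : 0 < δ) (hβ₀ : 0 < β₀) :
    (grid α δ β₀).Finite := by
  obtain ⟨K, hK⟩ := exists_gridPoint_ge hα hδ hβ₀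
  refine ((Set.finite_Iic K).image (gridPoint α δ β₀)).subset ?_
  rintro _ ⟨k, rfl, hk⟩
  exact ⟨k, not_lt.1 fun h => (hk K h).not_ge hK, rfl⟩

lemma le_of_mem_grid {α δ β₀ b : ℝ} (hα : Real.log α < 0) (hδ : 0 < δ) (hβ₀ : 0 < β₀)
    (hb : b ∈ grid α δ β₀) : β₀ ≤ b := by
  obtain ⟨K, rfl, hK⟩ := hb
  exact gridPoint_mem_Ici hα hδ hβ₀ hK

lemma self_mem_grid (α δ β₀ : ℝ) : β₀ ∈ grid α δ β₀ := ⟨0, rfl, by simp⟩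

/-- Every risk level above `β₀` is approximated from below by a grid point. -/
lemma exists_mem_grid_le {α δ β₀ β : ℝ} (hα : Real.log α < 0) (hδ : 0 < δ) (hβ₀ : 0 < β₀)
    (hβ : β₀ ≤ β) :
    ∃ b ∈ grid α δ β₀, b ≤ β ∧ β⁻¹ * Real.log α ≤ b⁻¹ * Real.log α + δ := by
  by_contra! hcon
  have key : ∀ K : ℕ, (∀ k < K, gridPoint α δ β₀ k < -Real.log α / δ) ∧
      gridPoint α δ β₀ K ≤ β := by
    intro K
    induction K with
    | zero => exact ⟨by simp, hβ⟩
    | succ K ih =>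
      have hb := hcon _ ⟨K, rfl, ih.1⟩ ih.2
      have hpos := hβ₀.trans_le (gridPoint_mem_Ici hα hδ hβ₀ ih.1)
      have hβneg : β⁻¹ * Real.log α < 0 :=
        mul_neg_of_pos_of_neg (inv_pos.2 (hβ₀.trans_le hβ)) hα
      -- At a point beyond the threshold, $b^{-1}\log\alpha+\delta\ge0>\beta^{-1}\log\alpha$, so it
      -- would already serve as the required grid point.
      have hlt : gridPoint α δ β₀ K < -Real.log α / δ := by
        by_contra! hge
        rw [div_le_iff₀ hδ, ← div_le_iff₀' hpos, div_eq_inv_mul] at hge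
        linarith
      refine ⟨fun k hk => ?_, ?_⟩
      · rcases Nat.lt_succ_iff_lt_or_eq.1 hk with h | rfl
        · exact ih.1 k h
        · exact hlt
      · refine (min_le_left _ _).trans ?_
        obtain ⟨h1, h2⟩ := gridPoint_inv hα hδ hpos hlt
        by_contra! hlt'
        have h3 := mul_le_mul_of_nonpos_right
          (inv_anti₀ (hβ₀.trans_le hβ) hlt'.le) hα.le
        linarith
  obtain ⟨K, hK⟩ := exists_gridPoint_ge hα hδ hβ₀
  exact ((key (K + 1)).1 K (by omega)).not_ge hK

namespace MDP

variable {S A : Type u} [Fintype S] [Fintype A] {M : MDP S A}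

/-! ### The halving loop -/

lemma HalvingLoop.pos {δ β β' : ℝ} (h : M.HalvingLoop δ β β') (hβ : 0 < β) : 0 < β' := by
  induction h with
  | exit => exact hβ
  | step _ _ _ _ ih => exact ih (by linarith)

lemma HalvingLoop.not_gt {δ β β' : ℝ} (h : M.HalvingLoop δ β β') :
    ¬ M.gInfStar 0 - M.gInfStar β' > (δ : EReal) := by
  induction h with
  | exit _ h => exact h
  | step _ _ _ _ ih => exact ih

lemma exists_halvingLoop_of_not_gt {δ : ℝ} (n : ℕ) :
    ∀ β : ℝ, ¬ M.gInfStar 0 - M.gInfStar (β / 2 ^ n) > (δ : EReal) →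
      ∃ β', M.HalvingLoop δ β β' := by
  induction n with
  | zero => exact fun β h => ⟨β, .exit β (by simpa using h)⟩
  | succ n ih =>
    intro β h
    by_cases hβ : M.gInfStar 0 - M.gInfStar β > (δ : EReal)
    · obtain ⟨β', h'⟩ := ih (β / 2) (by rwa [div_div, ← pow_succ'])
      exact ⟨β', .step β β' hβ h'⟩
    · exact ⟨β, .exit β hβ⟩

/-- When the loop stops, the risk level is so small that the risk-neutral value is `δ`-close. -/
lemma gInfStar_zero_le_add {δ β : ℝ}
    (h : ¬ M.gInfStar 0 - M.gInfStar β > (δ : EReal)) :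
    M.gInfStar 0 ≤ M.gInfStar β + (δ : EReal) := by
  rw [gt_iff_lt, not_lt] at h
  rw [add_comm]
  exact (EReal.sub_le_iff_le_add (Or.inr (EReal.coe_ne_top δ)) (Or.inr (EReal.coe_ne_bot δ))).1 h

/-! ### Values of the linear programs -/

lemma lpValue_eq (α β : ℝ) (w : S → ℝ) :
    M.lpValue α β w = -β⁻¹ * Real.log (∑ s, M.μ s * sinkExt 1 (fun s => -w s) s)
      + β⁻¹ * Real.log α := by
  rw [sum_μ_mul]
  rfl

lemma hInf_le_gInfStar (α β : ℝ) (π : Policy S A) :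
    M.hInf α π β ≤ M.gInfStar β + ((β⁻¹ * Real.log α : ℝ) : EReal) :=
  add_le_add_left (gInf_le_gInfStar π β) _

variable [Nonempty A]

lemma Transient.gInfStar_zero_ne_bot (hM : M.Transient) : M.gInfStar 0 ≠ ⊥ := by
  obtain ⟨v, -, hv⟩ := hM.exists_riskNeutral_value
  obtain ⟨β, hβ, hβ0 : 0 < β⟩ := ((hv 1 one_pos).and self_mem_nhdsWithin).exists
  exact ne_bot_of_le_ne_bot (EReal.coe_ne_bot _)
    (hβ.trans (gInfStar_antitone le_rfl hβ0.le))

lemma Transient.exists_halvingLoop (hM : M.Transient) {δ β₀ : ℝ} (hδ : 0 < δ) (hβ₀ : 0 < β₀) :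
    ∃ β, M.HalvingLoop δ β₀ β := by
  obtain ⟨v, hv, hv'⟩ := hM.exists_riskNeutral_value
  have hlim : Tendsto (fun n : ℕ => β₀ / 2 ^ n) atTop (𝓝[>] 0) := by
    refine tendsto_nhdsWithin_iff.2 ⟨?_, Eventually.of_forall fun n => ?_⟩
    · exact tendsto_const_nhds.div_atTop (tendsto_pow_atTop_atTop_of_one_lt one_lt_two)
    · exact div_pos hβ₀ (by positivity)
  obtain ⟨n, hn⟩ := (hlim.eventually (hv' δ hδ)).exists
  refine exists_halvingLoop_of_not_gt n β₀ (not_lt.2 ?_)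
  refine (EReal.sub_le_sub hv hn).trans ?_
  rw [← EReal.coe_sub, sub_sub_cancel]

/-! ### Optimality of the linear programs -/

/-- If a linear program has an optimal solution, its value bounds the optimal value. -/
lemma Transient.gInfStar_add_le_lpValue (hM : M.Transient) (hμ : ∀ s : S, 0 < M.μ (some s))
    {α β : ℝ} (hβ : 0 < β) {w : S → ℝ} (hw : M.IsLPSolution β w) :
    M.gInfStar β + ((β⁻¹ * Real.log α : ℝ) : EReal) ≤ (M.lpValue α β w : EReal) := by
  rw [lpValue_eq, EReal.coe_add]
  exact add_le_add_left ((hw.isMinLimit hμ hM).gInfStar_le hM hβ) _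

/-- The linear program of a risk level with a finite value has an optimal solution. -/
lemma Transient.exists_isLPSolution (hM : M.Transient) (hμ : ∀ s : S, 0 < M.μ (some s)) {β : ℝ}
    (hβ : 0 < β) (h : M.gInfStar β ≠ ⊥) : ∃ w, M.IsLPSolution β w := by
  obtain ⟨z, hz⟩ | ⟨-, -, hs⟩ := exists_isMinLimit_or_tendsto hμ β
  · exact ⟨_, hz.isLPSolution hM⟩
  · exact absurd (hM.gInfStar_eq_bot hβ hs) h

/-- A decision rule read off from an optimal solution attains the value of the linear program. -/
lemma Transient.lpValue_le_hInf (hM : M.Transient) (hμ : ∀ s : S, 0 < M.μ (some s))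
    {α β : ℝ} (hβ : 0 < β) {w : S → ℝ} (hw : M.IsLPSolution β w) {d : S → A}
    (hd : ∀ s, M.bellman β w s (d s) = w s) :
    (M.lpValue α β w : EReal) ≤ M.hInf α (stationary d) β := by
  rw [lpValue_eq, EReal.coe_add]
  refine add_le_add_left (hM.le_gInf_stationary hβ (hw.isMinLimit hμ hM).sinkInd_le fun s => ?_) _
  rw [step_sinkExt_neg, hd, sinkExt_some]

lemma IsLPSolution.exists_rule (hM : M.Transient) (hμ : ∀ s : S, 0 < M.μ (some s))
    {β : ℝ} {w : S → ℝ} (hw : M.IsLPSolution β w) :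
    ∃ d : S → A, ∀ s, M.bellman β w s (d s) = w s := by
  obtain ⟨d, hd⟩ := (hw.isMinLimit hμ hM).exists_rule
  refine ⟨d, fun s => ?_⟩
  have := hd s
  rw [step_sinkExt_neg, sinkExt_some] at this
  linarith

/-- A level whose program has no solution has optimal value $-\infty$ and cannot compete. At the
others the program value bounds every policy, and the selected rule attains the best one. -/
lemma Transient.isArgmax_of_isLPSelection (hM : M.Transient) (hμ : ∀ s : S, 0 < M.μ (some s))
    {α : ℝ} {B : Set ℝ} (hB : ∀ b ∈ B, 0 < b) {d : S → A} (h : M.IsLPSelection α B d) :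
    M.IsArgmax α B d := by
  obtain ⟨b, hb, w, hw, hbest, hd⟩ := h
  refine ⟨b, hb, fun d' b' hb' => le_trans ?_ (hM.lpValue_le_hInf hμ (hB b hb) hw hd)⟩
  refine (hInf_le_gInfStar _ _ _).trans ?_
  by_cases hbot : M.gInfStar b' = ⊥
  · simp [hbot]
  · obtain ⟨w', hw'⟩ := hM.exists_isLPSolution hμ (hB b' hb') hbot
    exact (hM.gInfStar_add_le_lpValue hμ (hB b' hb') hw').trans
      (EReal.coe_le_coe_iff.2 (hbest b' hb' w' hw'))

lemma Transient.exists_isLPSelection (hM : M.Transient) (hμ : ∀ s : S, 0 < M.μ (some s))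
    {α : ℝ} {B : Set ℝ} (hB : ∀ b ∈ B, 0 < b) (hfin : B.Finite)
    (hex : ∃ b ∈ B, M.gInfStar b ≠ ⊥) : ∃ d : S → A, M.IsLPSelection α B d := by
  obtain ⟨b₁, hb₁, hne⟩ := hex
  have huniq : ∀ {b : ℝ} {w w' : S → ℝ}, M.IsLPSolution b w → M.IsLPSolution b w' → w = w' := by
    intro b w w' hw hw'
    have h1 := (hw.isMinLimit hμ hM).eq_of_isLPSolution hM hw'
    funext s
    simpa using (congrFun h1 (some s)).symm
  choose! w hw using fun (b : ℝ) (hb : ∃ w, M.IsLPSolution b w) => hb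
  obtain ⟨b, ⟨hb, hbsol⟩, hmax⟩ := Set.exists_max_image
    {b ∈ B | ∃ w, M.IsLPSolution b w} (fun b => M.lpValue α b (w b)) (hfin.subset fun _ h => h.1)
    ⟨b₁, hb₁, hM.exists_isLPSolution hμ (hB b₁ hb₁) hne⟩
  obtain ⟨d, hd⟩ := (hw b hbsol).exists_rule hM hμ
  refine ⟨d, b, hb, w b, hw b hbsol, fun b' hb' w' hw' => ?_, hd⟩
  rw [huniq hw' (hw b' ⟨w', hw'⟩)]
  exact hmax b' ⟨hb', w', hw'⟩

/-- At a fixed risk level, a bound for all stationary deterministic policies bounds the optimal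
value over all policies. -/
lemma Transient.gInfStar_add_le_of_forall_stationary (hM : M.Transient) (hμ : ∀ s : S, 0 < M.μ (some s))
    {α b : ℝ} (hb : 0 < b) {x : EReal}
    (hx : ∀ d : S → A, M.hInf α (stationary d) b ≤ x) :
    M.gInfStar b + ((b⁻¹ * Real.log α : ℝ) : EReal) ≤ x := by
  by_cases hbot : M.gInfStar b = ⊥
  · simp [hbot]
  · obtain ⟨w, hw⟩ := hM.exists_isLPSolution hμ hb hbot
    obtain ⟨d, hd⟩ := hw.exists_rule hM hμ
    exact (hM.gInfStar_add_le_lpValue hμ hb hw).trans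
      ((hM.lpValue_le_hInf hμ hb hw hd).trans (hx d))

/-- Every risk level is dominated, up to `δ`, by the best value on the grid. -/
lemma Transient.hInf_le_add (hM : M.Transient) (hμ : ∀ s : S, 0 < M.μ (some s))
    {α δ β₀ : ℝ} (hα : Real.log α < 0) (hδ : 0 < δ) (hβ₀ : 0 < β₀)
    (hexit : ¬ M.gInfStar 0 - M.gInfStar β₀ > (δ : EReal)) {x : EReal}
    (hx : ∀ d : S → A, ∀ b ∈ grid α δ β₀, M.hInf α (stationary d) b ≤ x)
    (π : Policy S A) {β : ℝ} (hβ : 0 < β) : M.hInf α π β ≤ x + (δ : EReal) := by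
  have hgrid : ∀ b ∈ grid α δ β₀, M.gInfStar b + ((b⁻¹ * Real.log α : ℝ) : EReal) ≤ x :=
    fun b hb => hM.gInfStar_add_le_of_forall_stationary hμ (hβ₀.trans_le (le_of_mem_grid hα hδ hβ₀ hb))
      fun d => hx d b hb
  rcases le_total β₀ β with hle | hle
  · obtain ⟨b, hb, hbβ, hlog⟩ := exists_mem_grid_le hα hδ hβ₀ hle
    have hb0 := hβ₀.trans_le (le_of_mem_grid hα hδ hβ₀ hb)
    calc M.hInf α π β ≤ M.gInfStar β + ((β⁻¹ * Real.log α : ℝ) : EReal) := hInf_le_gInfStar _ _ _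
      _ ≤ M.gInfStar b + ((b⁻¹ * Real.log α + δ : ℝ) : EReal) :=
          add_le_add (gInfStar_antitone hb0.le hbβ) (EReal.coe_le_coe_iff.2 hlog)
      _ = M.gInfStar b + ((b⁻¹ * Real.log α : ℝ) : EReal) + (δ : EReal) := by
          rw [EReal.coe_add, add_assoc]
      _ ≤ x + (δ : EReal) := add_le_add_left (hgrid b hb) _
  -- Below $\beta_0$ no grid point is needed: $g^\star_\infty(\beta)\le g^\star_\infty(0)\le
  -- g^\star_\infty(\beta_0)+\delta$, and the $\log\alpha$ term only improves at $\beta_0$.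
  · have hlog : β⁻¹ * Real.log α ≤ β₀⁻¹ * Real.log α :=
      mul_le_mul_of_nonpos_right (inv_anti₀ hβ hle) hα.le
    calc M.hInf α π β ≤ M.gInfStar β + ((β⁻¹ * Real.log α : ℝ) : EReal) := hInf_le_gInfStar _ _ _
      _ ≤ (M.gInfStar β₀ + (δ : EReal)) + ((β₀⁻¹ * Real.log α : ℝ) : EReal) :=
          add_le_add ((gInfStar_antitone le_rfl hβ.le).trans (MDP.gInfStar_zero_le_add hexit))
            (EReal.coe_le_coe_iff.2 hlog)
      _ = M.gInfStar β₀ + ((β₀⁻¹ * Real.log α : ℝ) : EReal) + (δ : EReal) := add_right_comm _ _ _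
      _ ≤ x + (δ : EReal) := add_le_add_left (hgrid _ (self_mem_grid α δ β₀)) _

end MDP

/-! ### Assembly of the main theorem -/

theorem mainTheorem6 {S A : Type u} [Fintype S] [Fintype A] [Nonempty A] (M : MDP S A)
    (hμ : ∀ s : S, 0 < M.μ (some s)) (hM : M.Transient)
    (α δ β₀ : ℝ) (hα0 : 0 < α) (hα1 : α < 1) (hδ : 0 < δ) (hβ₀ : 0 < β₀) :
    -- the loop terminates, with a positive risk level whose grid is finite
    (∃ β, M.HalvingLoop δ β₀ β ∧ 0 < β ∧ (grid α δ β).Finite) ∧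
    -- the algorithm returns a policy, and the linear programs compute the argmax in its last line
    (∃ d : S → A, M.EVaRAlgorithmLP α δ β₀ d) ∧
    (∀ d : S → A, M.EVaRAlgorithmLP α δ β₀ d → M.EVaRAlgorithm α δ β₀ d) ∧
    -- all limits exist, and every policy that the algorithm may return is `δ`-optimal
    ∃ V : Policy S A → EReal,
      (∀ π, Tendsto (fun t => M.evarReturn α t π) atTop (𝓝 (V π))) ∧
      (∀ π, Tendsto (fun t => ⨆ (β : ℝ) (_ : 0 < β), (M.h α t π β : EReal)) atTop (𝓝 (V π))) ∧
      ∀ d : S → A, M.EVaRAlgorithm α δ β₀ d →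
        (⨆ π : Policy S A, V π) - (δ : EReal) ≤ V (stationary d) := by
  have hα := Real.log_neg hα0 hα1
  obtain ⟨β, hloop⟩ := hM.exists_halvingLoop hδ hβ₀
  have hβ := hloop.pos hβ₀
  have hpos : ∀ {β : ℝ}, 0 < β → ∀ b ∈ grid α δ β, 0 < b := fun hβ b hb =>
    hβ.trans_le (le_of_mem_grid hα hδ hβ hb)
  refine ⟨⟨β, hloop, hβ, grid_finite hα hδ hβ⟩, ?_, ?_, ?_⟩
  -- The exit test rules out $-\infty$ at the final level since the risk-neutral value is not
  -- $-\infty$. So at least one program on the grid is solvable.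
  · have hne : M.gInfStar β ≠ ⊥ := fun hbot => by
      have := MDP.gInfStar_zero_le_add hloop.not_gt
      rw [hbot, EReal.bot_add, le_bot_iff] at this
      exact hM.gInfStar_zero_ne_bot this
    obtain ⟨d, hd⟩ := hM.exists_isLPSelection hμ (α := α) (hpos hβ) (grid_finite hα hδ hβ)
      ⟨β, self_mem_grid α δ β, hne⟩
    exact ⟨d, β, hloop, hd⟩
  · rintro d ⟨β, hloop, hd⟩
    exact ⟨β, hloop, hM.isArgmax_of_isLPSelection hμ (hpos (hloop.pos hβ₀)) hd⟩
  · refine ⟨fun π => ⨆ (β : ℝ) (_ : 0 < β), M.hInf α π β, fun π => ?_,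
      hM.tendsto_iSup_h hα0 hα1, ?_⟩
    · simp only [MDP.evarReturn_eq hα0]
      exact hM.tendsto_iSup_h hα0 hα1 π
    · rintro d ⟨β, hloop, b, hb, hmax⟩
      have hβ := hloop.pos hβ₀
      refine EReal.sub_le_of_le_add (iSup_le fun π => iSup₂_le fun β' hβ' => ?_)
      refine (hM.hInf_le_add hμ hα hδ hβ hloop.not_gt hmax π hβ').trans ?_
      exact add_le_add_left (le_iSup₂ (f := fun (β : ℝ) (_ : 0 < β) =>
        M.hInf α (stationary d) β) b (hpos hβ b hb)) _
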